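/- Let $k$ be a finite field, $F=k((t))$, $\mathcal O_F=k[[t]]$, $G=\mathrm{GL}_2$, $Z$ the center of $G(F)$, $\mathfrak M=M_2(\mathcal O_F)$ and $K=G(\mathcal O_F)$. All representations are on vector spaces over an algebraically closed field $C$ of characteristic $0$ (e.g. $\overline{\mathbb Q}_\ell$ with $\ell\ne\mathrm{char}\,k$). Let $m\ge 0$, let $K_m=G(\mathcal O_F/t^{m+1})$, and let $N_m^m\subseteq K_m$ be the group of matrices $\begin{pmatrix}1&u\\0&1\end{pmatrix}$ with $u\in t^m\mathcal O_F/t^{m+1}\mathcal O_F$. Notation. For an $\mathcal O_F$-lattice chain $\dots\supsetneq L_i\supsetneq L_{i+1}\supsetneq\dots$ in $F^2$ with $tL_i=L_{i+e}$, put $\mathfrak A=\{x\in M_2(F): xL_i\subseteq L_i\ \forall i\}$ (a chain order, with $e_{\mathfrak A}=e$), $\mathfrak P^n=\{x\in M_2(F): xL_i\subseteq L_{i+n}\ \forall i\}$ for $n\in\mathbb Z$, and $U_{\mathfrak A}^n=1+\mathfrak P^n$ for $n\ge1$. For an irreducible smooth representation $\pi$ of $G(F)$, the level $\ell(\pi)$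 is the minimum of $n/e_{\mathfrak A}$ over all chain orders $\mathfrak A$ and integers $n\ge 0$ such that $\pi$ has a nonzero vector fixed by $U_{\mathfrak A}^{n+1}$. A stratum is a triple $(\mathfrak A,n,a)$ with $n\ge1$ and $a\in\mathfrak P^{-n}$. Fix an additive character $\psi$ of $F$ of level one, i.e. trivial on $t\mathcal O_F$ but not on $\mathcal O_F$; $\pi$ contains $(\mathfrak A,n,a)$ if $U_{\mathfrak A}^n$ acts on some nonzero vector of $\pi$ by the character $x\mapsto\psi(\mathrm{tr}(a(x-1)))$. If $e_{\mathfrak A}=1$, let $\tilde f_a\in k[T]$ be the reduction modulo $t$ of the characteristic polynomial of $t^na\in\mathfrak A$; the stratum is unramified simple if $\tilde f_a$ is irreducible, and essentially scalar if $\tilde f_a=(T-\lambda)^2$ with $\lambda\in k^\times$. A smooth irreducible representation $V$ of $G(F)$ is cuspidal if $V$ is spanned by the vectors $nv-v$ with $v\in V$ and $n$ upper triangular unipotent. For a smooth character $\phi$ of $F^\times$, $\phi\pi$ denotes $g\mapsto\phi(\det g)\pi(g)$. Proposition. Let $\Xi$ be a representation of $ZK$ whose restriction to $K$ is the inflation of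 an irreducible representation $\xi$ of $K_m$ that does not contain the trivial character on $N_m^m$. Then $\Pi_\Xi=\text{c-Ind}_{ZK}^{G(F)}\Xi$ is irreducible, cuspidal and admissible. If $m>0$, then, for every $\psi$ of level one, $\Pi_\Xi$ contains an unramified simple stratum $(\mathfrak M,m,\alpha)$ for some $\alpha\in t^{-m}\mathfrak M$, and $\Pi_\Xi$ contains no essentially scalar stratum; moreover $\ell(\Pi_\Xi)=m$, and for every smooth character $\phi$ of $F^\times$ one has $0<\ell(\Pi_\Xi)\le\ell(\phi\Pi_\Xi)$. -/

import Mathlib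

open scoped LaurentSeries PowerSeries Pointwise MatrixGroups

noncomputable section

namespace GLTwo

/-! ### Smooth representations and compact induction -/

section Generic

variable {C G V W : Type*} [Field C] [Group G] [TopologicalSpace G]
  [AddCommGroup V] [Module C V] [AddCommGroup W] [Module C W]

/-- Every vector has an open stabilizer. -/
def IsSmooth (π : Representation C G V) : Prop :=
  ∀ v : V, IsOpen {g : G | π g v = v}

/-- The subspace of vectors fixed by a subgroup. -/
def fixedVectors (π : Representation C G V) (H : Subgroup G) : Submodule C V where
  carrier := {v | ∀ h ∈ H, π h v = v}
  add_mem' {v w} hv hw h hh := by rw [map_add, hv h hh, hw h hh]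
  zero_mem' h _ := map_zero _
  smul_mem' c v hv h hh := by rw [map_smul, hv h hh]

/-- Smooth, with finite-dimensional fixed spaces for all compact open subgroups. -/
structure IsAdmissible (π : Representation C G V) : Prop where
  smooth : IsSmooth π
  finite : ∀ H : Subgroup G, IsOpen (H : Set G) → IsCompact (H : Set G) →
    FiniteDimensional C (fixedVectors π H)

/-- The restriction of `π` to the subset (in practice: subgroup) `S` contains the
one-dimensional representation `θ`: some nonzero vector transforms under `S` by `θ`. -/
def ContainsCharOn {G : Type*} [Group G]
    (π : Representation C G V) (S : Set G) (θ : G → C) : Prop :=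
  ∃ v : V, v ≠ 0 ∧ ∀ g ∈ S, π g v = θ g • v

/-- The space of `c-Ind_H^G ρ`: functions `f : G → W` with `f (h g) = ρ h (f g)`, invariant under
right translation by some open subgroup, and compactly supported modulo `H`. -/
def cIndSpace [IsTopologicalGroup G] (H : Subgroup G) (ρ : Representation C H W) :
    Submodule C (G → W) where
  carrier := {f | (∀ (h : H) (g : G), f (h * g) = ρ h (f g)) ∧
    (∃ U : Subgroup G, IsOpen (U : Set G) ∧ ∀ u ∈ U, ∀ g, f (g * u) = f g) ∧
    (∃ D : Set G, IsCompact D ∧ Function.support f ⊆ (H : Set G) * D)}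
  add_mem' := by
    rintro f₁ f₂ ⟨a₁, ⟨U₁, o₁, b₁⟩, ⟨D₁, c₁, d₁⟩⟩ ⟨a₂, ⟨U₂, o₂, b₂⟩, ⟨D₂, c₂, d₂⟩⟩
    refine ⟨fun h g => ?_, ⟨U₁ ⊓ U₂, ?_, fun u hu g => ?_⟩, ⟨D₁ ∪ D₂, c₁.union c₂, ?_⟩⟩
    · simp only [Pi.add_apply, a₁, a₂, map_add]
    · rw [Subgroup.coe_inf]; exact o₁.inter o₂
    · simp only [Pi.add_apply, b₁ u hu.1, b₂ u hu.2]
    · rw [Set.mul_union]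
      exact (Function.support_add f₁ f₂).trans (Set.union_subset_union d₁ d₂)
  zero_mem' := by
    refine ⟨fun h g => ?_, ⟨⊤, ?_, fun u _ g => rfl⟩, ⟨∅, isCompact_empty, ?_⟩⟩
    · simp
    · simp
    · simp
  smul_mem' := by
    rintro c f ⟨a, ⟨U, o, b⟩, ⟨D, e, d⟩⟩
    refine ⟨fun h g => ?_, ⟨U, o, fun u hu g => ?_⟩, ⟨D, e, ?_⟩⟩
    · simp only [Pi.smul_apply, a, map_smul]
    · simp only [Pi.smul_apply, b u hu]
    · exact (Function.support_const_smul_subset c f).trans d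

lemma translate_mem_cIndSpace [IsTopologicalGroup G] (H : Subgroup G) (ρ : Representation C H W)
    (x : G) {f : G → W} (hf : f ∈ cIndSpace H ρ) : (fun g => f (g * x)) ∈ cIndSpace H ρ := by
  obtain ⟨a, ⟨U, o, b⟩, ⟨D, e, d⟩⟩ := hf
  refine ⟨fun h g => ?_, ⟨U.comap (MulAut.conj x⁻¹).toMonoidHom, ?_, fun u hu g => ?_⟩,
    ⟨(fun y => y * x⁻¹) '' D, e.image (by fun_prop), ?_⟩⟩
  · simp only [mul_assoc, a]
  · have hc : Continuous fun y : G => x⁻¹ * y * x⁻¹⁻¹ := by fun_prop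
    exact o.preimage hc
  · have := b _ hu (g * x)
    simpa [mul_assoc] using this
  · intro g hg
    obtain ⟨h, hh, y, hy, hxy⟩ := d (show g * x ∈ Function.support f from hg)
    exact ⟨h, hh, y * x⁻¹, ⟨y, hy, rfl⟩, by
      simp only at hxy ⊢; rw [← mul_assoc, hxy, mul_inv_cancel_right]⟩

/-- The compactly induced representation `c-Ind_H^G ρ`; `G` acts by right translation. -/
def cInd [IsTopologicalGroup G] (H : Subgroup G) (ρ : Representation C H W) :
    Representation C G (cIndSpace H ρ) where
  toFun x :=
    { toFun := fun f => ⟨fun g => f.1 (g * x), translate_mem_cIndSpace H ρ x f.2⟩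
      map_add' := fun _ _ => rfl
      map_smul' := fun _ _ => rfl }
  map_one' := by ext f g; simp
  map_mul' x y := by ext f g; simp [mul_assoc]

end Generic

/-! ### The group `GL₂(F)`, `F = k((t))`, and its subgroups -/

section Groups

variable (k : Type*) [Field k]

/-- The uniformizer `t` of `F = k((t))`. -/
def unif : k⸨X⸩ := algebraMap k⟦X⟧ k⸨X⸩ PowerSeries.X

/-- `K = GL₂(O_F)` as a subgroup of `GL₂(F)`. -/
def maxCompact : Subgroup (GL (Fin 2) k⸨X⸩) :=
  (Matrix.GeneralLinearGroup.map (n := Fin 2) (algebraMap k⟦X⟧ k⸨X⸩)).range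

/-- `ZK`, with `Z` the center of `GL₂(F)`. -/
def ZK : Subgroup (GL (Fin 2) k⸨X⸩) := Subgroup.center (GL (Fin 2) k⸨X⸩) ⊔ maxCompact k

/-- The embedding of `GL₂(O_F)` into `ZK`. -/
def toZK : GL (Fin 2) k⟦X⟧ →* ZK k :=
  (Subgroup.inclusion (le_sup_right : maxCompact k ≤ ZK k)).comp
    (Matrix.GeneralLinearGroup.map (n := Fin 2) (algebraMap k⟦X⟧ k⸨X⸩)).rangeRestrict

/-- `O_F / t^(m+1)`. -/
abbrev TruncRing (m : ℕ) : Type _ := k⟦X⟧ ⧸ Ideal.span {(PowerSeries.X : k⟦X⟧) ^ (m + 1)}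

/-- `K_m = GL₂(O_F / t^(m+1))`, which is `K / K^(m+1)`. -/
abbrev FiniteLevel (m : ℕ) : Type _ := GL (Fin 2) (TruncRing k m)

/-- Reduction modulo `t^(m+1)`. -/
def reduction (m : ℕ) : GL (Fin 2) k⟦X⟧ →* FiniteLevel k m :=
  Matrix.GeneralLinearGroup.map (Ideal.Quotient.mk _)

/-- `N_m^i`: the upper triangular unipotent matrices in `K_m` congruent to `1` modulo `t^i`. -/
def unipFiltration (m i : ℕ) : Set (FiniteLevel k m) :=
  {g | ∃ u ∈ Ideal.span {(Ideal.Quotient.mk _ PowerSeries.X : TruncRing k m) ^ i},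
    g = Matrix.GeneralLinearGroup.upperRightHom u}

end Groups

/-! ### Cuspidality and twisting -/

section Reps

variable {k C V : Type*} [Field k] [Field C] [AddCommGroup V] [Module C V]

/-- An irreducible smooth representation of `GL₂(F)` is cuspidal if its Jacquet module
`V / V(N)` vanishes; here `V(N)` is spanned by the vectors `π(n) v - v`, with `n` in the group
`N` of upper triangular unipotent matrices. -/
structure IsCuspidal (π : Representation C (GL (Fin 2) k⸨X⸩) V) : Prop where
  irreducible : π.IsIrreducible
  smooth : IsSmooth π
  jacquet : Submodule.span C {w : V | ∃ (x : k⸨X⸩) (v : V),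
    w = π (Matrix.GeneralLinearGroup.upperRightHom x) v - v} = ⊤

/-- The twist `φ π : g ↦ φ (det g) π g`. -/
def twist (φ : k⸨X⸩ˣ →* Cˣ) (π : Representation C (GL (Fin 2) k⸨X⸩) V) :
    Representation C (GL (Fin 2) k⸨X⸩) V where
  toFun g := (φ (Matrix.GeneralLinearGroup.det g) : C) • π g
  map_one' := by simp
  map_mul' g h := by
    ext v
    simp only [map_mul, Units.val_mul, LinearMap.smul_apply, Module.End.mul_apply, mul_smul,
      map_smul]
    exact smul_comm _ _ _

end Reps

/-! ### Lattice chains, strata and levels -/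

section Strata

/-- An `O_F`-lattice chain in `F²`, indexed by `ℤ`, with period `e`. -/
structure LatticeChain (k : Type*) [Field k] where
  L : ℤ → Submodule k⟦X⟧ (Fin 2 → k⸨X⸩)
  isLattice : ∀ i, Submodule.IsLattice k⸨X⸩ (L i)
  strictAnti : StrictAnti L
  e : ℕ
  period : ∀ i, (PowerSeries.X : k⟦X⟧) • L i = L (i + e)

variable {k : Type*} [Field k]

/-- For the chain order `𝔄 = {x | x L_i ⊆ L_i for all i}` with radical `𝔓`, this is
`𝔓^n = {x | x L_i ⊆ L_(i+n) for all i}`, for an integer `n`; in particular `𝔓^0 = 𝔄`. -/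
def LatticeChain.radPow (Λ : LatticeChain k) (n : ℤ) : Set (Matrix (Fin 2) (Fin 2) k⸨X⸩) :=
  {x | ∀ i, ∀ v ∈ Λ.L i, x.mulVec v ∈ Λ.L (i + n)}

/-- `U^n = 1 + 𝔓^n`, used for `n ≥ 1`. -/
def LatticeChain.unitGroup (Λ : LatticeChain k) (n : ℕ) : Set (GL (Fin 2) k⸨X⸩) :=
  {g | (g : Matrix (Fin 2) (Fin 2) k⸨X⸩) - 1 ∈ Λ.radPow n}

/-- `v ↦ t^i v`, from `O_F²` to `F²`. -/
def scaleMap (k : Type*) [Field k] (i : ℤ) : (Fin 2 → k⟦X⟧) →ₗ[k⟦X⟧] (Fin 2 → k⸨X⸩) where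
  toFun v j := unif k ^ i * algebraMap k⟦X⟧ k⸨X⸩ (v j)
  map_add' v w := by ext1 j; simp [mul_add]
  map_smul' c v := by
    ext1 j
    simp only [Pi.smul_apply, smul_eq_mul, map_mul, RingHom.id_apply, Algebra.smul_def]
    ring

lemma unif_ne_zero (k : Type*) [Field k] : unif k ≠ 0 := by
  unfold unif
  rw [Ne, FaithfulSMul.algebraMap_eq_zero_iff]
  exact PowerSeries.X_ne_zero

/-- The chain `L_i = t^i O_F²`, of period `1`; its chain order is `𝔐 = M₂(O_F)`, and
`𝔓^n = t^n 𝔐`. -/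
def stdChain (k : Type*) [Field k] : LatticeChain k where
  L i := LinearMap.range (scaleMap k i)
  isLattice i :=
    { fg := by
        rw [← Submodule.map_top]
        exact Submodule.FG.map _ Module.Finite.fg_top
      span_eq_top := by
        rw [eq_top_iff, ← (Pi.basisFun k⸨X⸩ (Fin 2)).span_eq, Submodule.span_le]
        rintro _ ⟨j, rfl⟩
        have h : scaleMap k i (Pi.single j 1) ∈
            Submodule.span k⸨X⸩ (LinearMap.range (scaleMap k i) : Set (Fin 2 → k⸨X⸩)) :=
          Submodule.subset_span ⟨_, rfl⟩
        have h2 := Submodule.smul_mem _ (unif k ^ i)⁻¹ h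
        have h3 : Pi.basisFun k⸨X⸩ (Fin 2) j =
            (unif k ^ i)⁻¹ • scaleMap k i (Pi.single j 1) := by
          ext1 l
          have ht := zpow_ne_zero i (unif_ne_zero k)
          by_cases hl : l = j
          · subst hl; simp [scaleMap, ht]
          · simp [scaleMap, hl]
        rw [h3]
        exact h2 }
  strictAnti := by
    refine strictAnti_int_of_succ_lt fun i => ?_
    have ht := unif_ne_zero k
    refine lt_of_le_of_ne ?_ fun h => ?_
    · rintro _ ⟨v, rfl⟩
      refine ⟨(PowerSeries.X : k⟦X⟧) • v, ?_⟩
      ext1 j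
      simp only [scaleMap, LinearMap.coe_mk, AddHom.coe_mk, Pi.smul_apply, smul_eq_mul, map_mul]
      rw [zpow_add_one₀ ht, unif]
      ring
    · have h1 : scaleMap k i (fun _ => 1) ∈ LinearMap.range (scaleMap k (i + 1)) := by
        rw [h]; exact ⟨_, rfl⟩
      obtain ⟨w, hw⟩ := h1
      have h0 := congrFun hw 0
      simp only [scaleMap, LinearMap.coe_mk, AddHom.coe_mk, zpow_add_one₀ ht, mul_assoc] at h0
      have h3 := mul_left_cancel₀ (zpow_ne_zero i ht) h0
      rw [unif, ← map_mul] at h3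
      have h4 := FaithfulSMul.algebraMap_injective k⟦X⟧ k⸨X⸩ h3
      have h5 := congrArg PowerSeries.constantCoeff h4
      simp at h5
  e := 1
  period i := by
    have ht := unif_ne_zero k
    ext x
    rw [Submodule.mem_smul_pointwise_iff_exists]
    constructor
    · rintro ⟨_, ⟨v, rfl⟩, rfl⟩
      refine ⟨v, ?_⟩
      ext1 j
      simp only [scaleMap, LinearMap.coe_mk, AddHom.coe_mk, Pi.smul_apply, Nat.cast_one,
        Algebra.smul_def]
      rw [zpow_add_one₀ ht, unif]
      ring
    · rintro ⟨v, rfl⟩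
      refine ⟨_, ⟨v, rfl⟩, ?_⟩
      ext1 j
      simp only [scaleMap, LinearMap.coe_mk, AddHom.coe_mk, Pi.smul_apply, Nat.cast_one,
        Algebra.smul_def]
      rw [zpow_add_one₀ ht, unif]
      ring

/-- A stratum `(𝔄, n, a)`: a chain order, given by its lattice chain, an integer `n ≥ 1`, and an
element `a ∈ 𝔓^(-n)`. -/
structure Stratum (k : Type*) [Field k] where
  chain : LatticeChain k
  n : ℕ
  n_pos : 0 < n
  a : Matrix (Fin 2) (Fin 2) k⸨X⸩
  mem : a ∈ chain.radPow (-n)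

/-- For a stratum with `e = 1`, the matrix `a₀ = t^n a` lies in `𝔄`, so that its characteristic
polynomial has coefficients in `O_F`. This says that `f` is the reduction of that polynomial
modulo `t`. -/
def Stratum.IsReducedCharpoly (s : Stratum k) (f : Polynomial k) : Prop :=
  ∃ F : Polynomial k⟦X⟧, F.map (algebraMap k⟦X⟧ k⸨X⸩) = (unif k ^ s.n • s.a).charpoly ∧
    f = F.map PowerSeries.constantCoeff

/-- Unramified simple: `e = 1` and the reduced characteristic polynomial is irreducible. -/
def Stratum.IsUnramifiedSimple (s : Stratum k) : Prop :=
  s.chain.e = 1 ∧ ∃ f : Polynomial k, s.IsReducedCharpoly f ∧ Irreducible f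

/-- Essentially scalar: `e = 1` and the reduced characteristic polynomial has a nonzero repeated
root in `k`. -/
def Stratum.IsEssentiallyScalar (s : Stratum k) : Prop :=
  s.chain.e = 1 ∧ ∃ c : k, c ≠ 0 ∧ s.IsReducedCharpoly ((Polynomial.X - Polynomial.C c) ^ 2)

variable {C V : Type*} [Field C] [AddCommGroup V] [Module C V]

/-- An additive character of `F` of level one: trivial on `t O_F` but not on `O_F`. -/
def IsLevelOne (ψ : AddChar k⸨X⸩ C) : Prop :=
  (∀ x : k⟦X⟧, ψ (algebraMap k⟦X⟧ k⸨X⸩ (PowerSeries.X * x)) = 1) ∧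
    ∃ x : k⟦X⟧, ψ (algebraMap k⟦X⟧ k⸨X⸩ x) ≠ 1

/-- `π` contains the stratum `(𝔄, n, a)` (with respect to `ψ`): its restriction to `U^n` contains
the character `ψ_a(x) = ψ (tr (a (x - 1)))`. -/
def ContainsStratum (ψ : AddChar k⸨X⸩ C) (π : Representation C (GL (Fin 2) k⸨X⸩) V)
    (s : Stratum k) : Prop :=
  ContainsCharOn π (s.chain.unitGroup s.n)
    (fun g => ψ (s.a * ((g : Matrix (Fin 2) (Fin 2) k⸨X⸩) - 1)).trace)

/-- `π` has normalized level `r`: `r` is the minimum of `n / e_𝔄` over all chain orders `𝔄` and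
integers `n ≥ 0` such that `π` contains the trivial character of `U^(n+1)`. -/
def HasLevel (π : Representation C (GL (Fin 2) k⸨X⸩) V) (r : ℚ) : Prop :=
  IsLeast {x : ℚ | ∃ (Λ : LatticeChain k) (n : ℕ),
    ContainsCharOn π (Λ.unitGroup (n + 1)) (fun _ => 1) ∧ x = (n : ℚ) / (Λ.e : ℚ)} r

end Strata

end GLTwo

end

/-!
By the Cartan decomposition, `GL₂(F)` is the union of the double cosets of `diag(1, t^j)`, `j ≥ 0`,
with respect to `ZK` and `K`, so that a function in the induced space is governed by its values at
the elements `diag(1, t^j) κ` with `κ ∈ K`. Conjugation by `diag(1, t^j)` turns the upper unipotent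
matrices with entry in `t^m O_F` into matrices congruent to `1` modulo `t^(m+j)`. As `ξ` has no
nonzero vector fixed by `N_m^m`, a function fixed by `1 + t^(m+1) M₂(O_F)` therefore vanishes
outside `ZK`: this gives irreducibility and admissibility. Moreover the sum of the elements of
`N_m^m` kills `ξ`, so that every vector of `ξ` is a combination of vectors `n v - v`: this gives
cuspidality.

The group `1 + t^m M₂(O_F)` acts on `Ξ` through the abelian group `M₂(k)`, hence has an eigenvector,
with eigencharacter `x ↦ ψ(tr(a x))`. An eigenline of `a` would produce a conjugate of `N_m^m` which
fixes that eigenvector; so the characteristic polynomial of `a` has no root in `k`, and being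
quadratic is irreducible. The same dichotomy, applied to the values of an eigenfunction of the
induced representation, excludes the essentially scalar strata. Finally, if `n < m e` then `U^(n+1)`
of a chain order of period `e` contains, up to conjugation, all unipotent matrices with entry in
`t^m O_F`. These have determinant `1`, so twisting by `φ ∘ det` cannot lower the level below `m`.
-/

open Matrix.GeneralLinearGroup (upperRightHom)

namespace GLTwo

local notation "ιO" => algebraMap (PowerSeries _) (LaurentSeries _)

/-! ### Fractional ideals and the topology of `F` -/

section Field

variable {k : Type*} [Field k]

/-- The fractional ideal `t^n O_F`. -/
def fracIdeal (k : Type*) [Field k] (n : ℤ) : Submodule k⟦X⟧ k⸨X⸩ where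
  carrier := {x | ∃ y : k⟦X⟧, x = unif k ^ n * ιO y}
  add_mem' := by
    rintro _ _ ⟨x, rfl⟩ ⟨y, rfl⟩
    exact ⟨x + y, by rw [map_add, mul_add]⟩
  zero_mem' := ⟨0, by rw [map_zero, mul_zero]⟩
  smul_mem' := by
    rintro c _ ⟨y, rfl⟩
    exact ⟨c * y, by rw [Algebra.smul_def, map_mul, mul_left_comm]⟩

lemma mem_fracIdeal {n : ℤ} {x : k⸨X⸩} :
    x ∈ fracIdeal k n ↔ ∃ y : k⟦X⟧, x = unif k ^ n * ιO y := Iff.rfl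

lemma mem_fracIdeal_zero {x : k⸨X⸩} : x ∈ fracIdeal k 0 ↔ ∃ y : k⟦X⟧, x = ιO y := by
  simp only [mem_fracIdeal, zpow_zero, one_mul]

lemma algebraMap_X_pow (n : ℕ) : ιO ((PowerSeries.X : k⟦X⟧) ^ n) = unif k ^ (n : ℤ) := by
  rw [map_pow, zpow_natCast, unif]

lemma algebraMap_powerSeries_injective : Function.Injective (algebraMap k⟦X⟧ k⸨X⸩) :=
  FaithfulSMul.algebraMap_injective _ _

lemma algebraMap_mem_fracIdeal_natCast {n : ℕ} {y : k⟦X⟧} :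
    ιO y ∈ fracIdeal k n ↔ PowerSeries.X ^ n ∣ y := by
  simp only [mem_fracIdeal, ← algebraMap_X_pow, ← map_mul,
    algebraMap_powerSeries_injective.eq_iff, Dvd.dvd]

lemma algebraMap_mem_fracIdeal_one {y : k⟦X⟧} :
    ιO y ∈ fracIdeal k 1 ↔ PowerSeries.constantCoeff y = 0 := by
  rw [← Nat.cast_one, algebraMap_mem_fracIdeal_natCast, pow_one, PowerSeries.X_dvd_iff]

lemma mul_mem_fracIdeal {a b : ℤ} {x y : k⸨X⸩} (hx : x ∈ fracIdeal k a)
    (hy : y ∈ fracIdeal k b) : x * y ∈ fracIdeal k (a + b) := by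
  obtain ⟨x, rfl⟩ := hx
  obtain ⟨y, rfl⟩ := hy
  exact ⟨x * y, by rw [map_mul, zpow_add₀ (unif_ne_zero k), mul_mul_mul_comm]⟩

lemma fracIdeal_antitone : Antitone (fracIdeal k) := by
  rintro a b hab _ ⟨y, rfl⟩
  obtain ⟨d, rfl⟩ := Int.le.dest hab
  exact ⟨PowerSeries.X ^ d * y,
    by rw [map_mul, algebraMap_X_pow, zpow_add₀ (unif_ne_zero k), mul_assoc]⟩

lemma unif_zpow_mem_fracIdeal (n : ℤ) : unif k ^ n ∈ fracIdeal k n :=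
  ⟨1, by rw [map_one, mul_one]⟩

lemma unif_zpow_mul_mem_fracIdeal {a b : ℤ} {x : k⸨X⸩} :
    unif k ^ a * x ∈ fracIdeal k b ↔ x ∈ fracIdeal k (b - a) := by
  constructor
  · intro h
    have h' := mul_mem_fracIdeal (unif_zpow_mem_fracIdeal (-a)) h
    rwa [← mul_assoc, ← zpow_add₀ (unif_ne_zero k), neg_add_cancel, zpow_zero, one_mul,
      neg_add_eq_sub] at h'
  · intro h
    simpa only [add_sub_cancel] using mul_mem_fracIdeal (unif_zpow_mem_fracIdeal a) h

lemma exists_mem_fracIdeal (x : k⸨X⸩) : ∃ n, x ∈ fracIdeal k n := by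
  refine ⟨x.order, x.powerSeriesPart, ?_⟩
  rw [unif, LaurentSeries.coe_algebraMap, HahnSeries.ofPowerSeries_X, ← RatFunc.single_zpow]
  exact x.single_order_mul_powerSeriesPart.symm

lemma exists_eq_unit_mul_X_pow {y : k⟦X⟧} (hy : y ≠ 0) :
    ∃ (n : ℕ) (u : k⟦X⟧ˣ), y = (u : k⟦X⟧) * (PowerSeries.X : k⟦X⟧) ^ n :=
  IsDiscreteValuationRing.eq_unit_mul_pow_irreducible hy PowerSeries.X_irreducible

lemma exists_eq_unif_zpow_mul_unit {x : k⸨X⸩} (hx : x ≠ 0) :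
    ∃ (n : ℤ) (u : k⟦X⟧ˣ), x = unif k ^ n * ιO (u : k⟦X⟧) := by
  obtain ⟨n, y, rfl⟩ := exists_mem_fracIdeal x
  have hy : y ≠ 0 := by rintro rfl; rw [map_zero, mul_zero] at hx; exact hx rfl
  obtain ⟨d, u, rfl⟩ := exists_eq_unit_mul_X_pow hy
  exact ⟨n + d, u, by rw [zpow_add₀ (unif_ne_zero k), map_mul, algebraMap_X_pow]; ring⟩

lemma valuation_le_one_iff {x : k⸨X⸩} : Valued.v x ≤ 1 ↔ ∃ y : k⟦X⟧, x = ιO y := by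
  simp only [LaurentSeries.val_le_one_iff_eq_coe, eq_comm (a := x), LaurentSeries.coe_algebraMap]

lemma exists_eq_algebraMap_mul {x y : k⸨X⸩} (hx : x ≠ 0) (h : Valued.v y ≤ Valued.v x) :
    ∃ c : k⟦X⟧, y = ιO c * x := by
  obtain ⟨c, hc⟩ := valuation_le_one_iff.1
    (show Valued.v (y / x) ≤ 1 by rw [map_div₀]; exact div_le_one_of_le₀ h zero_le)
  exact ⟨c, by rw [← hc, div_mul_cancel₀ _ hx]⟩

lemma isOpen_fracIdeal (n : ℤ) : IsOpen (fracIdeal k n : Set k⸨X⸩) := by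
  have h0 : IsOpen {x : k⸨X⸩ | Valued.v x ≤ 1} := Valued.isOpen_integer k⸨X⸩
  have hc : Continuous fun x : k⸨X⸩ => unif k ^ (-n) * x := by fun_prop
  convert h0.preimage hc using 1
  ext x
  rw [Set.mem_preimage, Set.mem_ofPred_eq, valuation_le_one_iff, ← mem_fracIdeal_zero,
    unif_zpow_mul_mem_fracIdeal, zero_sub, neg_neg, SetLike.mem_coe]

open WithZero MonoidWithZeroHom in
lemma exists_fracIdeal_subset {s : Set k⸨X⸩} (hs : s ∈ nhds (0 : k⸨X⸩)) :
    ∃ n : ℕ, (fracIdeal k n : Set k⸨X⸩) ⊆ s := by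
  obtain ⟨γ, hγ⟩ := Valued.mem_nhds_zero.1 hs
  obtain ⟨n, hn⟩ : ∃ n : ℕ, exp (-(n : ℤ)) < ValueGroup₀.embedding γ.1 := by
    refine ⟨(1 - log (ValueGroup₀.embedding γ.1)).toNat, ?_⟩
    rw [← lt_log_iff_exp_lt (by simp)]
    omega
  refine ⟨n, ?_⟩
  rintro _ ⟨y, rfl⟩
  refine hγ ((Valuation.restrict_lt_iff_lt_embedding ..).2 (lt_of_le_of_lt ?_ hn))
  rw [map_mul, zpow_natCast, show Valued.v (unif k ^ n) = exp (-(n : ℤ)) from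
    LaurentSeries.valuation_X_pow k n]
  exact mul_le_of_le_one_right' (valuation_le_one_iff.2 ⟨y, rfl⟩)

lemma nhds_zero_hasBasis_fracIdeal :
    (nhds (0 : k⸨X⸩)).HasBasis (fun _ : ℕ => True) fun n => (fracIdeal k n : Set k⸨X⸩) :=
  ⟨fun _ => ⟨fun hs => (exists_fracIdeal_subset hs).imp fun _ h => ⟨trivial, h⟩,
    fun ⟨n, _, h⟩ => Filter.mem_of_superset
      ((isOpen_fracIdeal n).mem_nhds (fracIdeal k n).zero_mem) h⟩⟩

lemma exists_eq_smul_isCoprime {w : Fin 2 → k⸨X⸩} (hw : w ≠ 0) :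
    ∃ (c : k⸨X⸩) (v : Fin 2 → k⟦X⟧), c ≠ 0 ∧ IsCoprime (v 0) (v 1) ∧ ∀ i, w i = c * ιO (v i) := by
  obtain ⟨p, hp⟩ := Finite.exists_max fun i => Valued.v (w i)
  have hwp : w p ≠ 0 := by
    intro h
    refine hw (funext fun i => ?_)
    have := hp i
    rwa [h, map_zero, le_zero_iff, map_eq_zero] at this
  choose v hv using fun i => exists_eq_algebraMap_mul hwp (hp i)
  have hvp : v p = 1 := algebraMap_powerSeries_injective
    (by rw [map_one]; exact (mul_eq_right₀ hwp).1 (hv p).symm)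
  refine ⟨w p, v, hwp, ?_, fun i => (hv i).trans (mul_comm _ _)⟩
  fin_cases p
  · rw [show v 0 = 1 from hvp]
    exact isCoprime_one_left
  · rw [show v 1 = 1 from hvp]
    exact isCoprime_one_right

end Field

/-! ### Decompositions of `GL₂(F)` -/

section Decompositions

variable {k : Type*} [Field k]

/-- The embedding of `GL₂(O_F)` into `GL₂(F)`. -/
noncomputable abbrev toGL (k : Type*) [Field k] : GL (Fin 2) k⟦X⟧ →* GL (Fin 2) k⸨X⸩ :=
  Matrix.GeneralLinearGroup.map (n := Fin 2) (algebraMap k⟦X⟧ k⸨X⸩)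

lemma coe_toZK (κ : GL (Fin 2) k⟦X⟧) : (toZK k κ : GL (Fin 2) k⸨X⸩) = toGL k κ := rfl

lemma coe_toGL (κ : GL (Fin 2) k⟦X⟧) :
    (toGL k κ : Matrix (Fin 2) (Fin 2) k⸨X⸩) = (κ : Matrix (Fin 2) (Fin 2) k⟦X⟧).map ιO := rfl

lemma toGL_mem_ZK (κ : GL (Fin 2) k⟦X⟧) : toGL k κ ∈ ZK k := (toZK k κ).2

/-- The diagonal matrix with entries `1, t^j`. -/
noncomputable def diagPow (k : Type*) [Field k] (j : ℕ) : GL (Fin 2) k⸨X⸩ :=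
  Matrix.GeneralLinearGroup.mkOfDetNeZero !![1, 0; 0, unif k ^ j]
    (by simp [Matrix.det_fin_two, unif_ne_zero])

lemma coe_diagPow (j : ℕ) :
    (diagPow k j : Matrix (Fin 2) (Fin 2) k⸨X⸩) = !![1, 0; 0, unif k ^ j] := rfl

lemma diagPow_zero : diagPow k 0 = 1 :=
  Units.ext (by rw [coe_diagPow, pow_zero, ← Matrix.one_fin_two, Units.val_one])

lemma exists_map_eq_toGL_mul_diagPow_mul_toGL {A : Matrix (Fin 2) (Fin 2) k⟦X⟧}
    (hA : A 0 0 = 1) (hdet : A.det ≠ 0) :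
    ∃ (κ κ' : GL (Fin 2) k⟦X⟧) (j : ℕ),
      A.map ιO = (toGL k κ * diagPow k j * toGL k κ').1 := by
  obtain ⟨j, u, hu⟩ := exists_eq_unit_mul_X_pow hdet
  refine ⟨.mk'' !![1, 0; A 1 0, (u : k⟦X⟧)] (by simp [Matrix.det_fin_two]),
    upperRightHom (A 0 1), j, ?_⟩
  have hA11 : A 1 1 = A 1 0 * A 0 1 + (u : k⟦X⟧) * PowerSeries.X ^ j := by
    rw [← hu, Matrix.det_fin_two, hA]
    ring
  have hdiag : (diagPow k j).1 = (!![1, 0; 0, PowerSeries.X ^ j] : Matrix _ _ k⟦X⟧).map ιO := by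
    rw [coe_diagPow, ← zpow_natCast, ← algebraMap_X_pow]
    simp [← Matrix.ext_iff]
  have hfactor : A = !![1, 0; A 1 0, (u : k⟦X⟧)] * !![1, 0; 0, PowerSeries.X ^ j] *
      !![1, A 0 1; 0, 1] := by
    rw [Matrix.eta_fin_two A]
    simp [hA, hA11]
  rw [Units.val_mul, Units.val_mul, hdiag, coe_toGL, coe_toGL, ← Matrix.map_mul, ← Matrix.map_mul]
  exact congrArg (fun B : Matrix (Fin 2) (Fin 2) k⟦X⟧ => B.map ιO) hfactor

lemma exists_cartan_of_maximal_entry {g : GL (Fin 2) k⸨X⸩}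
    (hg : ∀ i j, Valued.v (g i j) ≤ Valued.v (g 0 0)) :
    ∃ ζ ∈ ZK k, ∃ (j : ℕ) (κ : GL (Fin 2) k⟦X⟧), g = ζ * diagPow k j * toGL k κ := by
  have h0 : g 0 0 ≠ 0 := by
    intro h0
    refine g.det.ne_zero (?_ : g.1.det = 0)
    have hzero : ∀ i j, g i j = 0 := fun i j => by
      have := hg i j
      rwa [h0, map_zero, le_zero_iff, map_eq_zero] at this
    simp only [Matrix.det_fin_two, hzero, mul_zero, sub_zero]
  choose A hA using fun i j => exists_eq_algebraMap_mul h0 (hg i j)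
  have hgA : g.1 = g 0 0 • (Matrix.of A).map ιO :=
    Matrix.ext fun i j => (hA i j).trans (mul_comm _ _)
  have hA00 : A 0 0 = 1 := algebraMap_powerSeries_injective
    (by rw [map_one]; exact (mul_eq_right₀ h0).1 (hA 0 0).symm)
  have hdet : (Matrix.of A).det ≠ 0 := by
    intro h
    refine g.det.ne_zero (?_ : g.1.det = 0)
    rw [hgA, Matrix.det_smul, ← RingHom.mapMatrix_apply, ← RingHom.map_det, h, map_zero, mul_zero]
  obtain ⟨κ, κ', j, h⟩ := exists_map_eq_toGL_mul_diagPow_mul_toGL (A := Matrix.of A) hA00 hdet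
  refine ⟨.scalar (Fin 2) (Units.mk0 _ h0) * toGL k κ, (ZK k).mul_mem (Subgroup.mem_sup_left ?_)
    (toGL_mem_ZK κ), j, κ', Units.ext ?_⟩
  · rw [Matrix.GeneralLinearGroup.center_eq_range_scalar]
    exact ⟨_, rfl⟩
  · rw [mul_assoc, mul_assoc, ← mul_assoc (toGL k κ), Units.val_mul, ← h]
    exact hgA.trans (Matrix.smul_eq_diagonal_mul _ _)

lemma coe_swap_mul_mul_swap {R n : Type*} [CommRing R] [Fintype n] [DecidableEq n]
    (g : GL n R) (p p' q q' i j : n) :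
    (.swap R p p' * g * .swap R q q' : GL n R) i j = g (Equiv.swap p p' i) (Equiv.swap q q' j) := by
  simp [Matrix.swap, PEquiv.toMatrix_toPEquiv_mul, PEquiv.mul_toMatrix_toPEquiv]

lemma exists_cartan (g : GL (Fin 2) k⸨X⸩) :
    ∃ ζ ∈ ZK k, ∃ (j : ℕ) (κ : GL (Fin 2) k⟦X⟧), g = ζ * diagPow k j * toGL k κ := by
  obtain ⟨⟨p, q⟩, hmax⟩ := Finite.exists_max fun r : Fin 2 × Fin 2 => Valued.v (g r.1 r.2)
  let s (i : Fin 2) : GL (Fin 2) k⟦X⟧ := .swap _ 0 i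
  have hs (i : Fin 2) : toGL k (s i) = .swap _ 0 i := Matrix.GeneralLinearGroup.map_swap ..
  have hss (i : Fin 2) : toGL k (s i) * toGL k (s i) = 1 := by
    rw [hs]; exact Units.ext (Matrix.swap_mul_self ..)
  obtain ⟨ζ, hζ, j, κ, h⟩ := exists_cartan_of_maximal_entry (g := toGL k (s p) * g * toGL k (s q))
    fun i j => by
      rw [hs, hs, coe_swap_mul_mul_swap, coe_swap_mul_mul_swap, Equiv.swap_apply_left,
        Equiv.swap_apply_left]
      exact hmax (_, _)
  refine ⟨toGL k (s p) * ζ, (ZK k).mul_mem (toGL_mem_ZK _) hζ, j, κ * s q, ?_⟩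
  calc g = toGL k (s p) * (toGL k (s p) * g * toGL k (s q)) * toGL k (s q) := by
        rw [mul_assoc, mul_assoc, hss, mul_one, ← mul_assoc, hss, one_mul]
    _ = _ := by rw [h, map_mul]; simp only [mul_assoc]

lemma exists_GL_firstColumn {R : Type*} [CommRing R] {v : Fin 2 → R}
    (hv : IsCoprime (v 0) (v 1)) : ∃ κ : GL (Fin 2) R, κ.1.det = 1 ∧ ∀ i, κ i 0 = v i := by
  obtain ⟨κ, h0, h1⟩ := hv.exists_SL2_col 0
  exact ⟨κ, κ.2, fun i => by fin_cases i <;> assumption⟩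

lemma exists_mul_toGL_apply_one_zero_eq_zero (g : GL (Fin 2) k⸨X⸩) :
    ∃ κ : GL (Fin 2) k⟦X⟧, (g * toGL k κ) 1 0 = 0 := by
  have hw : ![g 1 1, -g 1 0] ≠ 0 := by
    intro h
    have h0 : g 1 1 = 0 := congrFun h 0
    have h1 : g 1 0 = 0 := neg_eq_zero.1 (congrFun h 1)
    refine g.det.ne_zero (?_ : g.1.det = 0)
    rw [Matrix.det_fin_two, h0, h1, mul_zero, mul_zero, sub_zero]
  obtain ⟨c, v, hc, hv, hwv⟩ := exists_eq_smul_isCoprime hw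
  obtain ⟨κ, -, hκ⟩ := exists_GL_firstColumn hv
  refine ⟨κ, mul_left_cancel₀ hc ?_⟩
  rw [Units.val_mul, coe_toGL, Matrix.mul_apply, Fin.sum_univ_two, Matrix.map_apply,
    Matrix.map_apply, hκ, hκ, mul_add, mul_left_comm, mul_left_comm c, ← hwv, ← hwv]
  simp only [Matrix.cons_val_zero, Matrix.cons_val_one]
  ring

end Decompositions

/-! ### Congruence subgroups -/

section Congruence

variable {k : Type*} [Field k]

lemma isUnit_det_one_add_X_pow_smul {n : ℕ} (hn : 0 < n) (B : Matrix (Fin 2) (Fin 2) k⟦X⟧) :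
    IsUnit (1 + (PowerSeries.X : k⟦X⟧) ^ n • B).det := by
  have h : PowerSeries.constantCoeff.mapMatrix (1 + (PowerSeries.X : k⟦X⟧) ^ n • B) = 1 := by
    ext i j
    rw [map_add, map_one, Matrix.add_apply]
    simp [hn.ne']
  rw [PowerSeries.isUnit_iff_constantCoeff, RingHom.map_det, h, Matrix.det_one]
  exact isUnit_one

/-- The element `1 + t^n B` of `GL₂(O_F)`. -/
noncomputable def onePlus {n : ℕ} (hn : 0 < n) (B : Matrix (Fin 2) (Fin 2) k⟦X⟧) :
    GL (Fin 2) k⟦X⟧ :=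
  .mk'' (1 + (PowerSeries.X : k⟦X⟧) ^ n • B) (isUnit_det_one_add_X_pow_smul hn B)

lemma coe_onePlus {n : ℕ} (hn : 0 < n) (B : Matrix (Fin 2) (Fin 2) k⟦X⟧) :
    (onePlus hn B : Matrix (Fin 2) (Fin 2) k⟦X⟧) = 1 + (PowerSeries.X : k⟦X⟧) ^ n • B := rfl

lemma coe_toGL_onePlus {n : ℕ} (hn : 0 < n) (B : Matrix (Fin 2) (Fin 2) k⟦X⟧) :
    (toGL k (onePlus hn B)).1 = 1 + unif k ^ n • B.map ιO := by
  ext i j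
  rw [coe_toGL, Matrix.map_apply, coe_onePlus, Matrix.add_apply, map_add, Matrix.smul_apply,
    smul_eq_mul, map_mul, algebraMap_X_pow, zpow_natCast, Matrix.one_apply, Matrix.add_apply,
    Matrix.one_apply, apply_ite (algebraMap k⟦X⟧ k⸨X⸩), map_one, map_zero]
  rfl

lemma exists_toGL_onePlus_eq_iff {n : ℕ} (hn : 0 < n) {g : GL (Fin 2) k⸨X⸩} :
    (∃ B, toGL k (onePlus hn B) = g) ↔ ∀ i j, (g.1 - 1) i j ∈ fracIdeal k n := by
  constructor
  · rintro ⟨B, rfl⟩ i j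
    exact ⟨B i j, by rw [coe_toGL_onePlus, add_sub_cancel_left, zpow_natCast]; rfl⟩
  · intro h
    choose B hB using h
    refine ⟨.of B, Units.ext ?_⟩
    rw [coe_toGL_onePlus, ← eq_sub_iff_add_eq']
    exact Matrix.ext fun i j => by rw [hB, zpow_natCast]; rfl

lemma reduction_eq_iff {m : ℕ} {κ κ' : GL (Fin 2) k⟦X⟧} :
    reduction k m κ = reduction k m κ' ↔
      ∀ i j, (PowerSeries.X : k⟦X⟧) ^ (m + 1) ∣ κ i j - κ' i j := by
  simp only [Units.ext_iff, ← Matrix.ext_iff, ← Ideal.mem_span_singleton, ← Ideal.Quotient.eq]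
  rfl

lemma reduction_onePlus_eq_one {m n : ℕ} (hn : 0 < n) (hmn : m < n)
    (B : Matrix (Fin 2) (Fin 2) k⟦X⟧) : reduction k m (onePlus hn B) = 1 := by
  rw [← map_one (reduction k m), reduction_eq_iff]
  intro i j
  rw [coe_onePlus, Units.val_one, Matrix.add_apply, add_sub_cancel_left]
  exact (pow_dvd_pow _ hmn).mul_right _

lemma reduction_eq_one_iff {m : ℕ} {κ : GL (Fin 2) k⟦X⟧} :
    reduction k m κ = 1 ↔ ∃ B, κ = onePlus m.succ_pos B := by
  refine ⟨fun h => ?_, ?_⟩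
  · rw [← map_one (reduction k m), reduction_eq_iff] at h
    choose B hB using h
    exact ⟨.of B, Units.ext (sub_eq_iff_eq_add'.1 (Matrix.ext hB))⟩
  · rintro ⟨B, rfl⟩
    exact reduction_onePlus_eq_one _ m.lt_succ_self B

/-- The image in `GL₂(F)` of the principal congruence subgroup modulo `t^(n+1)`. -/
noncomputable def congruenceSubgroup (k : Type*) [Field k] (n : ℕ) : Subgroup (GL (Fin 2) k⸨X⸩) :=
  (reduction k n).ker.map (toGL k)

lemma mem_congruenceSubgroup {n : ℕ} {g : GL (Fin 2) k⸨X⸩} :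
    g ∈ congruenceSubgroup k n ↔ ∀ i j, (g.1 - 1) i j ∈ fracIdeal k (n + 1 : ℕ) := by
  rw [← exists_toGL_onePlus_eq_iff n.succ_pos]
  simp only [congruenceSubgroup, Subgroup.mem_map, MonoidHom.mem_ker, reduction_eq_one_iff]
  aesop

lemma isOpen_congruenceSubgroup (n : ℕ) :
    IsOpen (congruenceSubgroup k n : Set (GL (Fin 2) k⸨X⸩)) := by
  have h : (congruenceSubgroup k n : Set (GL (Fin 2) k⸨X⸩)) =
      ⋂ i, ⋂ j, (fun g : GL (Fin 2) k⸨X⸩ => (g.1 - 1) i j) ⁻¹' fracIdeal k (n + 1 : ℕ) := by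
    ext g
    simp only [Set.mem_iInter, Set.mem_preimage, SetLike.mem_coe, mem_congruenceSubgroup]
  rw [h]
  have hcont : Continuous fun g : GL (Fin 2) k⸨X⸩ => g.1 - 1 :=
    Units.continuous_val.sub continuous_const
  exact isOpen_iInter_of_finite fun i => isOpen_iInter_of_finite fun j =>
    (isOpen_fracIdeal _).preimage (hcont.matrix_elem i j)

lemma congruenceSubgroup_le_ZK (n : ℕ) : congruenceSubgroup k n ≤ ZK k := by
  rintro _ ⟨κ, -, rfl⟩
  exact toGL_mem_ZK κ

lemma isOpen_ZK : IsOpen (ZK k : Set (GL (Fin 2) k⸨X⸩)) :=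
  Subgroup.isOpen_mono (congruenceSubgroup_le_ZK 0) (isOpen_congruenceSubgroup 0)

lemma exists_forall_mem_of_mem_nhds_one {s : Set (Matrix (Fin 2) (Fin 2) k⸨X⸩)}
    (hs : s ∈ nhds 1) :
    ∃ n : ℕ, ∀ A : Matrix (Fin 2) (Fin 2) k⸨X⸩, (∀ i j, (A - 1) i j ∈ fracIdeal k n) → A ∈ s := by
  have hnhds : nhds (0 : Matrix (Fin 2) (Fin 2) k⸨X⸩) =
      Filter.pi fun _ => Filter.pi fun _ => nhds (0 : k⸨X⸩) :=
    nhds_pi.trans (congrArg Filter.pi (funext fun _ => nhds_pi))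
  have hadd : (fun A : Matrix (Fin 2) (Fin 2) k⸨X⸩ => A + 1) ⁻¹' s ∈ nhds 0 :=
    (continuous_add_const 1).continuousAt.preimage_mem_nhds (by rwa [zero_add])
  rw [hnhds] at hadd
  obtain ⟨⟨I, J, n⟩, -, h⟩ := nhds_zero_hasBasis_fracIdeal.pi_self.pi_self.mem_iff.1 hadd
  exact ⟨n, fun A hA => sub_add_cancel A 1 ▸ h fun i _ j _ => hA i j⟩

lemma exists_congruenceSubgroup_le {U : Subgroup (GL (Fin 2) k⸨X⸩)}
    (hU : IsOpen (U : Set (GL (Fin 2) k⸨X⸩))) : ∃ n, congruenceSubgroup k n ≤ U := by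
  have h1 : (U : Set (GL (Fin 2) k⸨X⸩)) ∈ nhds 1 := hU.mem_nhds U.one_mem
  rw [Units.isEmbedding_embedProduct.nhds_eq_comap, Filter.mem_comap] at h1
  obtain ⟨s, hs, hsU⟩ := h1
  rw [map_one, Prod.one_eq_mk, nhds_prod_eq, Filter.mem_prod_iff] at hs
  obtain ⟨s₁, hs₁, s₂, hs₂, hss⟩ := hs
  obtain ⟨n₁, h₁⟩ := exists_forall_mem_of_mem_nhds_one hs₁
  obtain ⟨n₂, h₂⟩ := exists_forall_mem_of_mem_nhds_one
    (MulOpposite.continuous_op.continuousAt.preimage_mem_nhds hs₂)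
  have hle (n : ℕ) (g : GL (Fin 2) k⸨X⸩) (hn : n ≤ n₁ + n₂ + 1)
      (hg : g ∈ congruenceSubgroup k (n₁ + n₂)) (i j : Fin 2) : (g.1 - 1) i j ∈ fracIdeal k n :=
    fracIdeal_antitone (by exact_mod_cast hn) (mem_congruenceSubgroup.1 hg i j)
  exact ⟨n₁ + n₂, fun g hg => hsU (hss ⟨h₁ _ (hle _ g (by omega) hg),
    h₂ _ (hle _ g⁻¹ (by omega) (inv_mem hg))⟩)⟩

end Congruence

/-! ### The finite quotients `K_m` -/

section FiniteLevel

variable {k : Type*} [Field k]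

instance nontrivial_truncRing (m : ℕ) : Nontrivial (TruncRing k m) := by
  refine Ideal.Quotient.nontrivial_iff.2 (Ideal.span_singleton_ne_top fun h => ?_)
  exact PowerSeries.X_prime.not_isUnit (isUnit_of_dvd_unit (dvd_pow_self _ m.succ_ne_zero) h)

instance finite_truncRing [Finite k] (m : ℕ) : Finite (TruncRing k m) := by
  refine Finite.of_surjective (fun c : Fin (m + 1) → k =>
    Ideal.Quotient.mk _ (PowerSeries.mk fun i => if h : i < m + 1 then c ⟨i, h⟩ else 0))
    fun x => ?_
  obtain ⟨y, rfl⟩ := Ideal.Quotient.mk_surjective x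
  refine ⟨fun i => PowerSeries.coeff i y, ?_⟩
  rw [Ideal.Quotient.eq, Ideal.mem_span_singleton, PowerSeries.X_pow_dvd_iff]
  intro i hi
  rw [map_sub, PowerSeries.coeff_mk, dif_pos hi, sub_self]

instance finite_finiteLevel [Finite k] (m : ℕ) : Finite (FiniteLevel k m) :=
  inferInstanceAs (Finite (Matrix (Fin 2) (Fin 2) (TruncRing k m))ˣ)

lemma generalLinearGroup_map_surjective {R S n : Type*} [CommRing R] [IsLocalRing R] [CommRing S]
    [Nontrivial S] [Fintype n] [DecidableEq n] {f : R →+* S} (hf : Function.Surjective f) :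
    Function.Surjective (Matrix.GeneralLinearGroup.map (n := n) f) := by
  intro g
  have := IsLocalHom.of_surjective f hf
  choose A hA using fun i j => hf (g i j)
  have hmap : f.mapMatrix (.of A) = g.1 := Matrix.ext hA
  have hdet : IsUnit (Matrix.of A).det := by
    refine isUnit_of_map_unit f _ ?_
    rw [RingHom.map_det, hmap]
    exact g.det.isUnit
  exact ⟨.mk'' (.of A) hdet, Units.ext hmap⟩

lemma reduction_surjective (m : ℕ) : Function.Surjective (reduction k m) :=
  generalLinearGroup_map_surjective Ideal.Quotient.mk_surjective

end FiniteLevel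

/-! ### Representations and compact induction -/

section Representations

variable {C G V : Type*} [Field C] [Group G] [AddCommGroup V] [Module C V]
  {π : Representation C G V}

lemma isIrreducible_of_forall_eq_top [Nontrivial V]
    (h : ∀ σ : Subrepresentation π, ∀ v ∈ σ, v ≠ 0 → σ = ⊤) : π.IsIrreducible where
  exists_pair_ne := ⟨⊥, ⊤, fun h => bot_ne_top (α := Submodule C V)
    (congrArg Subrepresentation.toSubmodule h)⟩
  eq_bot_or_eq_top σ := by
    by_cases hσ : ∃ v ∈ σ, v ≠ 0
    · obtain ⟨v, hv, hv0⟩ := hσ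
      exact Or.inr (h σ v hv hv0)
    · push Not at hσ
      exact Or.inl (Subrepresentation.toSubmodule_injective ((Submodule.eq_bot_iff _).2 hσ))

lemma eq_top_of_mem_of_ne_zero (hπ : π.IsIrreducible) {σ : Subrepresentation π} {v : V}
    (hv : v ∈ σ) (hv0 : v ≠ 0) : σ = ⊤ := by
  refine (hπ.eq_bot_or_eq_top σ).resolve_left ?_
  rintro rfl
  exact hv0 ((Submodule.mem_bot C).1 hv)

lemma nontrivial_of_isIrreducible (hπ : π.IsIrreducible) : Nontrivial V :=
  have := hπ.toNontrivial
  (Submodule.nontrivial_iff C).1 (Subrepresentation.toSubmodule_injective (ρ := π)).nontrivial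

/-- The subrepresentation of `π` generated by a set of vectors. -/
def subrepSpan (π : Representation C G V) (s : Set V) : Subrepresentation π where
  toSubmodule := Submodule.span C {w | ∃ g, ∃ v ∈ s, w = π g v}
  apply_mem_toSubmodule g w hw := by
    induction hw using Submodule.span_induction with
    | mem w hw =>
      obtain ⟨h, v, hv, rfl⟩ := hw
      exact Submodule.subset_span ⟨g * h, v, hv, by rw [map_mul, Module.End.mul_apply]⟩
    | zero => exact (map_zero (π g)).symm ▸ Submodule.zero_mem _
    | add x y _ _ hx hy => exact (map_add (π g) x y).symm ▸ Submodule.add_mem _ hx hy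
    | smul c x _ hx => exact (map_smul (π g) c x).symm ▸ Submodule.smul_mem _ c hx

lemma apply_mem_subrepSpan {s : Set V} (g : G) {v : V} (hv : v ∈ s) : π g v ∈ subrepSpan π s :=
  Submodule.subset_span ⟨g, v, hv, rfl⟩

lemma subset_subrepSpan (s : Set V) : s ⊆ subrepSpan π s := fun v hv =>
  Submodule.subset_span ⟨1, v, hv, by rw [map_one, Module.End.one_apply]⟩

lemma subrepSpan_le {s : Set V} {σ : Subrepresentation π} (h : s ⊆ σ) : subrepSpan π s ≤ σ := by
  refine Submodule.span_le (p := σ.toSubmodule).2 ?_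
  rintro _ ⟨g, v, hv, rfl⟩
  exact σ.apply_mem_toSubmodule g (h hv)

lemma finiteDimensional_of_isIrreducible [Finite G] (hπ : π.IsIrreducible) :
    FiniteDimensional C V := by
  have := nontrivial_of_isIrreducible hπ
  obtain ⟨v, hv⟩ := exists_ne (0 : V)
  have htop : subrepSpan π {v} = ⊤ :=
    eq_top_of_mem_of_ne_zero hπ (subset_subrepSpan {v} rfl) hv
  have hspan : Submodule.span C {w | ∃ g, ∃ u ∈ ({v} : Set V), w = π g u} = ⊤ :=
    congrArg Subrepresentation.toSubmodule htop
  refine ⟨hspan ▸ Submodule.fg_span ((Set.finite_range fun g => π g v).subset ?_)⟩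
  rintro _ ⟨g, _, rfl, rfl⟩
  exact ⟨g, rfl⟩

/-- The stabilizer in `G` of a vector of a representation. -/
def vectorStabilizer (π : Representation C G V) (v : V) : Subgroup G where
  carrier := {g | π g v = v}
  mul_mem' {a b} ha hb := by
    rw [Set.mem_ofPred_eq, map_mul, Module.End.mul_apply, hb, ha]
  one_mem' := by rw [Set.mem_ofPred_eq, map_one, Module.End.one_apply]
  inv_mem' {a} ha := by
    rw [Set.mem_ofPred_eq]
    conv_lhs => rw [← show π a v = v from ha]
    exact π.inv_self_apply a v

lemma mem_vectorStabilizer {v : V} {g : G} : g ∈ vectorStabilizer π v ↔ π g v = v := Iff.rfl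

/-- The sum of the translates of `v` over the cosets of `T`; it does not depend on the chosen
representatives when `v` is fixed by `T`. -/
noncomputable def cosetSum (π : Representation C G V) (T : Subgroup G) [Fintype (G ⧸ T)] (v : V) :
    V :=
  ∑ q : G ⧸ T, π q.out v

section CosetSum

variable {T : Subgroup G} [Fintype (G ⧸ T)] {v : V}

lemma apply_cosetSum (hv : T ≤ vectorStabilizer π v) (g : G) :
    π g (cosetSum π T v) = cosetSum π T v := by
  have hrep (a b : G) (hab : (a : G ⧸ T) = b) : π a v = π b v := by
    have h := mem_vectorStabilizer.1 (hv (QuotientGroup.eq.1 hab))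
    rw [map_mul, Module.End.mul_apply] at h
    rw [← π.self_inv_apply a (π b v), h]
  rw [cosetSum, map_sum]
  refine Fintype.sum_equiv (MulAction.toPerm g) _ _ fun q => ?_
  rw [← Module.End.mul_apply, ← map_mul]
  refine hrep _ _ ?_
  rw [MulAction.toPerm_apply, QuotientGroup.out_eq', ← smul_eq_mul,
    ← MulAction.Quotient.coe_smul_out]

lemma map_cosetSum {V' : Type*} [AddCommGroup V'] [Module C V'] {l : V →ₗ[C] V'}
    (hl : ∀ g, l (π g v) = l v) : l (cosetSum π T v) = (T.index : C) • l v := by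
  simp only [cosetSum, map_sum, hl, Finset.sum_const, Finset.card_univ, Nat.cast_smul_eq_nsmul,
    Subgroup.index_eq_card, Nat.card_eq_fintype_card]

lemma cosetSum_mem {σ : Submodule C V} (hσ : ∀ g, π g v ∈ σ) : cosetSum π T v ∈ σ :=
  Submodule.sum_mem σ fun _ _ => hσ _

end CosetSum

end Representations

section CompactInduction

variable {C G W : Type*} [Field C] [Group G] [AddCommGroup W] [Module C W]
  [TopologicalSpace G] [IsTopologicalGroup G] {H : Subgroup G} {ρ : Representation C H W}

lemma cInd_apply (x g : G) (f : cIndSpace H ρ) : (cInd H ρ x f).1 g = f.1 (g * x) := rfl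

lemma cInd_left_mul (f : cIndSpace H ρ) (h : H) (g : G) : f.1 (h * g) = ρ h (f.1 g) := f.2.1 h g

lemma isSmooth_cInd : IsSmooth (cInd H ρ) := by
  intro f
  obtain ⟨-, ⟨U, hU, hf⟩, -⟩ := f.2
  have hUf : U ≤ vectorStabilizer (cInd H ρ) f := fun u hu => Subtype.ext (funext (hf u hu))
  exact Subgroup.isOpen_mono hUf hU

open Classical in
/-- The element of `c-Ind_H^G ρ` supported on `H` with a given value at `1`. -/
noncomputable def cIndSingle (hH : IsOpen (H : Set G)) (hρ : IsSmooth ρ) :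
    W →ₗ[C] cIndSpace H ρ where
  toFun w := ⟨fun g => if hg : g ∈ H then ρ ⟨g, hg⟩ w else 0, by
    refine ⟨fun h g => ?_, ⟨(vectorStabilizer ρ w).map H.subtype,
      hH.isOpenMap_subtype_val _ (hρ w), ?_⟩, {1}, isCompact_singleton, fun g hg => ?_⟩
    · beta_reduce
      by_cases hg : g ∈ H
      · rw [dif_pos hg, dif_pos (H.mul_mem h.2 hg), ← Module.End.mul_apply, ← map_mul]
        rfl
      · rw [dif_neg hg, dif_neg (by rwa [H.mul_mem_cancel_left h.2]), map_zero]
    · rintro _ ⟨u, hu, rfl⟩ g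
      rw [Subgroup.subtype_apply]
      beta_reduce
      by_cases hg : g ∈ H
      · rw [dif_pos hg, dif_pos (H.mul_mem hg u.2)]
        exact (by rw [map_mul, Module.End.mul_apply, mem_vectorStabilizer.1 hu] :
          ρ (⟨g, hg⟩ * u) w = ρ ⟨g, hg⟩ w)
      · rw [dif_neg hg, dif_neg (by exact fun h => hg ((H.mul_mem_cancel_right u.2).1 h))]
    · exact ⟨g, by_contra fun hgH => hg (dif_neg hgH), 1, rfl, mul_one g⟩⟩
  map_add' w w' := by
    refine Subtype.ext (funext fun g => ?_)
    by_cases hg : g ∈ H <;> simp [hg]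
  map_smul' c w := by
    refine Subtype.ext (funext fun g => ?_)
    by_cases hg : g ∈ H <;> simp [hg]

variable (hH : IsOpen (H : Set G)) (hρ : IsSmooth ρ)

lemma cIndSingle_apply_mem (w : W) (h : H) : (cIndSingle hH hρ w).1 h = ρ h w := dif_pos h.2

lemma cIndSingle_apply_notMem (w : W) {g : G} (hg : g ∉ H) : (cIndSingle hH hρ w).1 g = 0 :=
  dif_neg hg

lemma cIndSingle_apply_one (w : W) : (cIndSingle hH hρ w).1 1 = w := by
  rw [← H.coe_one, cIndSingle_apply_mem, map_one, Module.End.one_apply]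

lemma cIndSingle_injective : Function.Injective (cIndSingle hH hρ) :=
  Function.LeftInverse.injective (g := fun f : cIndSpace H ρ => f.1 1) (cIndSingle_apply_one hH hρ)

lemma cInd_cIndSingle (h : H) (w : W) :
    cInd H ρ h (cIndSingle hH hρ w) = cIndSingle hH hρ (ρ h w) := by
  refine Subtype.ext (funext fun g => ?_)
  rw [cInd_apply]
  by_cases hg : g ∈ H
  · lift g to H using hg
    rw [← H.coe_mul, cIndSingle_apply_mem, cIndSingle_apply_mem, map_mul, Module.End.mul_apply]
  · rw [cIndSingle_apply_notMem _ _ _ hg,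
      cIndSingle_apply_notMem _ _ _ (by rwa [H.mul_mem_cancel_right h.2])]

lemma eq_cIndSingle_of_forall_notMem {f : cIndSpace H ρ} (hf : ∀ g ∉ H, f.1 g = 0) :
    f = cIndSingle hH hρ (f.1 1) := by
  refine Subtype.ext (funext fun g => ?_)
  by_cases hg : g ∈ H
  · lift g to H using hg
    rw [cIndSingle_apply_mem, ← cInd_left_mul, mul_one]
  · rw [hf g hg, cIndSingle_apply_notMem _ _ _ hg]

include hH in
lemma exists_finset_forall_support (f : cIndSpace H ρ) :
    ∃ t : Finset G, ∀ g, f.1 g ≠ 0 → ∃ d ∈ t, g * d⁻¹ ∈ H := by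
  obtain ⟨-, -, D, hD, hfD⟩ := f.2
  obtain ⟨t, -, ht⟩ := hD.elim_nhds_subcover (fun d => {g | g * d⁻¹ ∈ H}) fun d _ =>
    (hH.preimage (continuous_mul_const d⁻¹)).mem_nhds (by simp [H.one_mem])
  refine ⟨t, fun g hg => ?_⟩
  obtain ⟨h, hh, y, hy, rfl⟩ := hfD hg
  obtain ⟨d, hd, hyd⟩ := Set.mem_iUnion₂.1 (ht hy)
  exact ⟨d, hd, by simpa only [mul_assoc] using H.mul_mem hh hyd⟩

lemma mem_subrepSpan_cIndSingle (t : Finset G) (f : cIndSpace H ρ)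
    (hf : ∀ g, f.1 g ≠ 0 → ∃ d ∈ t, g * d⁻¹ ∈ H) :
    f ∈ subrepSpan (cInd H ρ) (Set.range (cIndSingle hH hρ)) := by
  classical
  induction t using Finset.induction_on generalizing f with
  | empty =>
    have hf0 : f = 0 := Subtype.ext (funext fun g => by_contra fun hg => by simpa using hf g hg)
    exact hf0 ▸ Submodule.zero_mem _
  | insert d t _ ih =>
    let f' := cInd H ρ d⁻¹ (cIndSingle hH hρ (f.1 d))
    have hf' : f' ∈ subrepSpan (cInd H ρ) (Set.range (cIndSingle hH hρ)) :=
      apply_mem_subrepSpan _ ⟨_, rfl⟩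
    refine (Submodule.sub_mem_iff_left _ hf').1 (ih _ fun g hg => ?_)
    have hval : (f - f').1 g = f.1 g - (cIndSingle hH hρ (f.1 d)).1 (g * d⁻¹) := rfl
    rw [hval] at hg
    by_cases hgd : g * d⁻¹ ∈ H
    · rw [cIndSingle_apply_mem hH hρ _ ⟨_, hgd⟩, ← cInd_left_mul, inv_mul_cancel_right,
        sub_self] at hg
      exact absurd rfl hg
    · rw [cIndSingle_apply_notMem _ _ _ hgd, sub_zero] at hg
      obtain ⟨d', hd', h⟩ := hf g hg
      exact ⟨d', (Finset.mem_insert.1 hd').resolve_left (by rintro rfl; exact hgd h), h⟩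

lemma subrepSpan_cIndSingle_eq_top :
    subrepSpan (cInd H ρ) (Set.range (cIndSingle hH hρ)) = ⊤ := by
  refine eq_top_iff.2 fun f _ => ?_
  obtain ⟨t, ht⟩ := exists_finset_forall_support hH f
  exact mem_subrepSpan_cIndSingle hH hρ t f ht

include hH hρ in
theorem cInd_isIrreducible_of_exists_forall_notMem (hirr : ρ.IsIrreducible)
    (h : ∀ σ : Subrepresentation (cInd H ρ), ∀ f ∈ σ, f.1 1 ≠ 0 →
      ∃ f' ∈ σ, f'.1 1 ≠ 0 ∧ ∀ g ∉ H, f'.1 g = 0) : (cInd H ρ).IsIrreducible := by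
  have := nontrivial_of_isIrreducible hirr
  have := (cIndSingle_injective hH hρ).nontrivial
  refine isIrreducible_of_forall_eq_top fun σ f hf hf0 => ?_
  obtain ⟨g, hg⟩ : ∃ g, f.1 g ≠ 0 := Function.ne_iff.1 fun h => hf0 (Subtype.ext h)
  obtain ⟨f', hf', hf'1, hsupp⟩ := h σ (cInd H ρ g f) (σ.apply_mem_toSubmodule g hf)
    (by rwa [cInd_apply, one_mul])
  let τ : Subrepresentation ρ := ⟨σ.toSubmodule.comap (cIndSingle hH hρ), fun x w hw => by
    rw [Submodule.mem_comap, ← cInd_cIndSingle]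
    exact σ.apply_mem_toSubmodule _ hw⟩
  have hτ : τ = ⊤ := by
    refine eq_top_of_mem_of_ne_zero hirr (v := f'.1 1) (Submodule.mem_comap.2 ?_) hf'1
    rwa [← eq_cIndSingle_of_forall_notMem hH hρ hsupp]
  rw [eq_top_iff, ← subrepSpan_cIndSingle_eq_top hH hρ]
  refine subrepSpan_le ?_
  rintro _ ⟨w, rfl⟩
  exact (hτ ▸ Submodule.mem_top : w ∈ τ)

end CompactInduction

/-! ### Irreducibility, cuspidality and admissibility of the induced representation -/

section PGroup

variable {k : Type*} [Field k]

lemma onePlus_pow_char_pow {p : ℕ} [Fact p.Prime] [CharP k p] {n : ℕ} (hn : 0 < n)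
    (B : Matrix (Fin 2) (Fin 2) k⟦X⟧) (r : ℕ) :
    onePlus hn B ^ p ^ r =
      onePlus (Nat.mul_pos hn (pow_pos (Fact.out : p.Prime).pos r)) (B ^ p ^ r) := by
  have : CharP k⟦X⟧ p := charP_of_injective_algebraMap PowerSeries.C_injective p
  have : CharP (Matrix (Fin 2) (Fin 2) k⟦X⟧) p := Matrix.charP p
  refine Units.ext ?_
  rw [Units.val_pow_eq_pow_val, coe_onePlus, coe_onePlus,
    add_pow_char_pow_of_commute p r (Commute.one_left _), one_pow, smul_pow, pow_mul]

lemma isPGroup_range_reduction_ker {p : ℕ} [Fact p.Prime] [CharP k p] (m n : ℕ) :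
    IsPGroup p ((reduction k n).comp (reduction k m).ker.subtype).range := by
  rintro ⟨_, ⟨κ, hκ⟩, rfl⟩
  obtain ⟨B, rfl⟩ := reduction_eq_one_iff.1 hκ
  refine ⟨n, Subtype.ext ?_⟩
  have hlt : n < (m + 1) * p ^ n :=
    (Nat.lt_pow_self (Fact.out : p.Prime).one_lt).trans_le (Nat.le_mul_of_pos_left _ m.succ_pos)
  change reduction k n (onePlus m.succ_pos B) ^ p ^ n = 1
  rw [← map_pow, onePlus_pow_char_pow, reduction_onePlus_eq_one _ hlt]

variable {C : Type*} [Field C] [Finite k]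

lemma index_ker_reduction_ne_zero (hchar : (ringChar k : C) ≠ 0) (m n : ℕ) :
    ((((reduction k n).comp (reduction k m).ker.subtype).ker.index : ℕ) : C) ≠ 0 := by
  have : Fact (ringChar k).Prime := ⟨CharP.char_is_prime k _⟩
  obtain ⟨s, hs⟩ := IsPGroup.iff_card.1
    (isPGroup_range_reduction_ker (k := k) (p := ringChar k) m n)
  rw [Subgroup.index_ker, hs, Nat.cast_pow]
  exact pow_ne_zero s hchar

lemma natCast_card_ne_zero (hchar : (ringChar k : C) ≠ 0) (M : Type*) [AddCommGroup M] [Module k M]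
    [Finite M] : (Nat.card M : C) ≠ 0 := by
  have := Fintype.ofFinite k
  obtain ⟨n, -, hn⟩ := FiniteField.card k (ringChar k)
  rw [Module.natCard_eq_pow_finrank (K := k), Nat.card_eq_fintype_card, hn, Nat.cast_pow,
    Nat.cast_pow]
  exact pow_ne_zero _ (pow_ne_zero _ hchar)

end PGroup

section Unipotent

lemma upperRightHom_conj_of_apply_one_zero_eq_zero {F : Type*} [Field F] {b : GL (Fin 2) F}
    (hb : b 1 0 = 0) (x : F) :
    b * upperRightHom x = upperRightHom (b 0 0 * x / b 1 1) * b := by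
  have h11 : b 1 1 ≠ 0 := fun h => b.det.ne_zero <| by
    rw [Matrix.GeneralLinearGroup.val_det_apply, Matrix.det_fin_two, hb, h, mul_zero, mul_zero,
      sub_zero]
  refine Units.ext (Matrix.ext fun i j => ?_)
  fin_cases i <;> fin_cases j <;>
    simp [Matrix.mul_apply, Fin.sum_univ_two, hb, div_mul_cancel₀ _ h11, add_comm]

lemma toGL_upperRightHom {k : Type*} [Field k] (y : k⟦X⟧) :
    toGL k (upperRightHom y) = upperRightHom (ιO y : k⸨X⸩) :=
  Units.ext (Matrix.ext fun i j => by fin_cases i <;> fin_cases j <;> simp)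

lemma reduction_upperRightHom {k : Type*} [Field k] (m : ℕ) (y : k⟦X⟧) :
    reduction k m (upperRightHom y) = upperRightHom (Ideal.Quotient.mk _ y) :=
  Units.ext (Matrix.ext fun i j => by fin_cases i <;> fin_cases j <;> simp [reduction])

lemma toGL_mul_diagPow {k : Type*} [Field k] {κ κ' : GL (Fin 2) k⟦X⟧} {j : ℕ}
    (h00 : κ' 0 0 = κ 0 0) (h01 : κ' 0 1 = PowerSeries.X ^ j * κ 0 1)
    (h10 : κ 1 0 = PowerSeries.X ^ j * κ' 1 0) (h11 : κ' 1 1 = κ 1 1) :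
    toGL k κ * diagPow k j = diagPow k j * toGL k κ' := by
  refine Units.ext (Matrix.ext fun i l => ?_)
  have hX (y : k⟦X⟧) : (ιO (PowerSeries.X ^ j * y) : k⸨X⸩) = unif k ^ j * ιO y := by
    rw [map_mul, algebraMap_X_pow, zpow_natCast]
  rw [Units.val_mul, Units.val_mul, coe_diagPow, coe_toGL, coe_toGL, Matrix.eta_fin_two κ.1,
    Matrix.eta_fin_two κ'.1, h00, h01, h10, h11]
  fin_cases i <;> fin_cases l <;>
    simp [-LaurentSeries.coe_algebraMap, hX, Matrix.mul_apply, Fin.sum_univ_two, mul_comm]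

variable {C k V : Type*} [Field C] [Field k] [AddCommGroup V] [Module C V]
  {π : Representation C (GL (Fin 2) k⸨X⸩) V}

/-- The kernel `V(N)` of the projection of `V` to its Jacquet module. -/
def jacquetKernel (π : Representation C (GL (Fin 2) k⸨X⸩) V) : Submodule C V :=
  Submodule.span C {w | ∃ (x : k⸨X⸩) (v : V), w = π (upperRightHom x) v - v}

lemma apply_mem_jacquetKernel {b : GL (Fin 2) k⸨X⸩} (hb : b 1 0 = 0) {v : V}
    (hv : v ∈ jacquetKernel π) : π b v ∈ jacquetKernel π := by
  suffices h : jacquetKernel π ≤ (jacquetKernel π).comap (π b) from h hv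
  refine Submodule.span_le.2 ?_
  rintro _ ⟨x, v, rfl⟩
  refine Submodule.subset_span ⟨b 0 0 * x / b 1 1, π b v, ?_⟩
  rw [map_sub, ← Module.End.mul_apply, ← map_mul,
    upperRightHom_conj_of_apply_one_zero_eq_zero hb, map_mul, Module.End.mul_apply]

lemma exists_mem_fixedVectors_congruenceSubgroup (hπ : IsSmooth π) (v : V) :
    ∃ n, v ∈ fixedVectors π (congruenceSubgroup k n) :=
  exists_congruenceSubgroup_le (U := vectorStabilizer π v) (hπ v)

end Unipotent

section Inflation

variable {k C W : Type*} [Field k] [Field C] [AddCommGroup W] [Module C W] {m : ℕ}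
  {ξ : Representation C (FiniteLevel k m) W} {Ξ : Representation C (ZK k) W}

lemma eq_zero_of_forall_diagPow_mul_toGL {f : cIndSpace (ZK k) Ξ}
    (h : ∀ j κ, f.1 (diagPow k j * toGL k κ) = 0) : f = 0 := by
  refine Subtype.ext (funext fun g => ?_)
  obtain ⟨ζ, hζ, j, κ, rfl⟩ := exists_cartan g
  rw [mul_assoc, cInd_left_mul f ⟨ζ, hζ⟩, h, map_zero]
  rfl

/-- The restriction of `Ξ` to `K` is the inflation of the representation `ξ` of `K_m`. -/
def IsInflation (ξ : Representation C (FiniteLevel k m) W) (Ξ : Representation C (ZK k) W) : Prop :=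
  ∀ κ, Ξ (toZK k κ) = ξ (reduction k m κ)

lemma eq_zero_of_forall_upperRightHom
    (hN : ¬ ContainsCharOn ξ (unipFiltration k m m) (fun _ => 1)) {w : W}
    (hw : ∀ y, ξ (reduction k m (upperRightHom (PowerSeries.X ^ m * y))) w = w) : w = 0 := by
  by_contra hw0
  refine hN ⟨w, hw0, ?_⟩
  rintro _ ⟨u, hu, rfl⟩
  obtain ⟨v, rfl⟩ := Ideal.mem_span_singleton.1 hu
  obtain ⟨y, rfl⟩ := Ideal.Quotient.mk_surjective v
  have h := hw y
  rw [reduction_upperRightHom, map_mul, map_pow] at h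
  rw [h, one_smul]

namespace IsInflation

variable (hΞ : IsInflation ξ Ξ)
include hΞ

lemma isIrreducible (hξ : ξ.IsIrreducible) : Ξ.IsIrreducible := by
  have := nontrivial_of_isIrreducible hξ
  refine isIrreducible_of_forall_eq_top fun σ w hw hw0 => ?_
  let τ : Subrepresentation ξ := ⟨σ.toSubmodule, fun g u hu => by
    obtain ⟨κ, rfl⟩ := reduction_surjective m g
    exact hΞ κ ▸ σ.apply_mem_toSubmodule (toZK k κ) hu⟩
  have hτ : τ = ⊤ := eq_top_of_mem_of_ne_zero hξ (v := w) hw hw0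
  exact Subrepresentation.toSubmodule_injective (congrArg (·.toSubmodule) hτ)

lemma isSmooth : IsSmooth Ξ := by
  intro w
  have hle : (congruenceSubgroup k m).subgroupOf (ZK k) ≤ vectorStabilizer Ξ w := by
    rintro u ⟨κ, hκ, hu⟩
    have hu : u = toZK k κ := Subtype.ext hu.symm
    rw [mem_vectorStabilizer, hu, hΞ, MonoidHom.mem_ker.1 hκ, map_one, Module.End.one_apply]
  exact Subgroup.isOpen_mono hle
    ((isOpen_congruenceSubgroup m).preimage continuous_subtype_val)

lemma cInd_toGL_mul (f : cIndSpace (ZK k) Ξ) (κ : GL (Fin 2) k⟦X⟧) (g : GL (Fin 2) k⸨X⸩) :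
    f.1 (toGL k κ * g) = ξ (reduction k m κ) (f.1 g) := by
  rw [← hΞ, ← cInd_left_mul, coe_toZK]

/-- The function in `c-Ind Ξ` supported on `ZK` with a given value at `1`. -/
noncomputable def single : W →ₗ[C] cIndSpace (ZK k) Ξ := cIndSingle isOpen_ZK hΞ.isSmooth

lemma cInd_toGL_single (κ : GL (Fin 2) k⟦X⟧) (w : W) :
    cInd (ZK k) Ξ (toGL k κ) (hΞ.single w) = hΞ.single (ξ (reduction k m κ) w) := by
  rw [single, ← coe_toZK, cInd_cIndSingle, hΞ]

variable (hN : ¬ ContainsCharOn ξ (unipFiltration k m m) (fun _ => 1))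
include hN

lemma cInd_apply_eq_zero_of_forall_upperRightHom {f : cIndSpace (ZK k) Ξ} {g : GL (Fin 2) k⸨X⸩}
    (hf : ∀ y, f.1 (toGL k (upperRightHom (PowerSeries.X ^ m * y)) * g) = f.1 g) : f.1 g = 0 :=
  eq_zero_of_forall_upperRightHom hN fun y => by rw [← hΞ.cInd_toGL_mul, hf]

end IsInflation

lemma cInd_apply_mul_toGL_eq {n : ℕ} {f : cIndSpace (ZK k) Ξ}
    (hf : f ∈ fixedVectors (cInd (ZK k) Ξ) (congruenceSubgroup k n)) {κ κ' : GL (Fin 2) k⟦X⟧}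
    (h : reduction k n κ = reduction k n κ') (g : GL (Fin 2) k⸨X⸩) :
    f.1 (g * toGL k κ) = f.1 (g * toGL k κ') := by
  have hmem : toGL k (κ⁻¹ * κ') ∈ congruenceSubgroup k n :=
    ⟨_, MonoidHom.mem_ker.2 (by rw [map_mul, map_inv, h, inv_mul_cancel]), rfl⟩
  have hval := congrFun (congrArg Subtype.val (hf _ hmem)) (g * toGL k κ)
  rw [cInd_apply, mul_assoc, ← map_mul, mul_inv_cancel_left] at hval
  exact hval.symm

namespace IsInflation

variable (hΞ : IsInflation ξ Ξ)
  (hN : ¬ ContainsCharOn ξ (unipFiltration k m m) (fun _ => 1))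
include hΞ hN

lemma cInd_diagPow_eq_zero {n : ℕ} {f : cIndSpace (ZK k) Ξ}
    (hf : f ∈ fixedVectors (cInd (ZK k) Ξ) (congruenceSubgroup k n)) {j : ℕ} (hj : n < m + j)
    (κ : GL (Fin 2) k⟦X⟧) : f.1 (diagPow k j * toGL k κ) = 0 := by
  refine hΞ.cInd_apply_eq_zero_of_forall_upperRightHom hN fun y => ?_
  let μ : GL (Fin 2) k⟦X⟧ := upperRightHom (PowerSeries.X ^ j * (PowerSeries.X ^ m * y))
  have hμ : reduction k n μ = 1 := by
    rw [← map_one (reduction k n), reduction_eq_iff]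
    have hdvd : (PowerSeries.X : k⟦X⟧) ^ (n + 1) ∣ PowerSeries.X ^ j * (PowerSeries.X ^ m * y) := by
      rw [← mul_assoc, ← pow_add, add_comm j]
      exact (pow_dvd_pow _ hj).mul_right y
    intro i l
    fin_cases i <;> fin_cases l <;> simp [μ, hdvd]
  have hconj : toGL k (upperRightHom (PowerSeries.X ^ m * y)) * diagPow k j =
      diagPow k j * toGL k μ := by
    apply toGL_mul_diagPow <;> simp [μ]
  rw [← mul_assoc, hconj, mul_assoc, ← map_mul]
  exact cInd_apply_mul_toGL_eq hf (by rw [map_mul, hμ, one_mul]) _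

lemma cInd_eq_zero_of_notMem_ZK {f : cIndSpace (ZK k) Ξ}
    (hf : f ∈ fixedVectors (cInd (ZK k) Ξ) (congruenceSubgroup k m))
    {g : GL (Fin 2) k⸨X⸩} (hg : g ∉ ZK k) : f.1 g = 0 := by
  obtain ⟨ζ, hζ, j, κ, rfl⟩ := exists_cartan g
  rw [mul_assoc] at hg ⊢
  rw [cInd_left_mul f ⟨ζ, hζ⟩]
  rcases Nat.eq_zero_or_pos j with rfl | hj
  · rw [diagPow_zero, one_mul] at hg
    exact absurd ((ZK k).mul_mem hζ (toGL_mem_ZK κ)) hg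
  · rw [hΞ.cInd_diagPow_eq_zero hN hf (by lia), map_zero]

lemma eq_zero_of_forall_le_diagPow_mul_toGL {n : ℕ} {f : cIndSpace (ZK k) Ξ}
    (hf : f ∈ fixedVectors (cInd (ZK k) Ξ) (congruenceSubgroup k n))
    (h : ∀ j ≤ n, ∀ κ, f.1 (diagPow k j * toGL k κ) = 0) : f = 0 := by
  refine eq_zero_of_forall_diagPow_mul_toGL fun j κ => ?_
  rcases le_or_gt j n with hj | hj
  · exact h j hj κ
  · exact hΞ.cInd_diagPow_eq_zero hN hf (by lia) κ

omit hΞ in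
lemma sum_upperRightHom_eq_zero [Fintype (TruncRing k m)] (w : W) :
    ∑ y : TruncRing k m,
      ξ (upperRightHom (Ideal.Quotient.mk _ (PowerSeries.X ^ m : k⟦X⟧) * y)) w = 0 := by
  refine eq_zero_of_forall_upperRightHom hN fun z => ?_
  rw [map_sum, reduction_upperRightHom]
  refine Fintype.sum_equiv (Equiv.addLeft (Ideal.Quotient.mk _ z)) _ _ fun y => ?_
  rw [← Module.End.mul_apply, ← map_mul, ← AddChar.map_add_eq_mul, Equiv.coe_addLeft, mul_add,
    map_mul]

section Finite

variable [Finite k]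

theorem cInd_isAdmissible (hξ : ξ.IsIrreducible) : IsAdmissible (cInd (ZK k) Ξ) where
  smooth := isSmooth_cInd
  finite H hH _ := by
    have := finiteDimensional_of_isIrreducible hξ
    obtain ⟨n, hn⟩ := exists_congruenceSubgroup_le hH
    choose lift hlift using reduction_surjective (k := k) n
    let Φ : cIndSpace (ZK k) Ξ →ₗ[C] (Fin (n + 1) × FiniteLevel k n → W) :=
      (LinearMap.funLeft C W fun p => diagPow k p.1 * toGL k (lift p.2)).comp
        (cIndSpace (ZK k) Ξ).subtype
    refine Module.Finite.of_injective (Φ.domRestrict (fixedVectors _ H)) ?_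
    refine (injective_iff_map_eq_zero _).2 fun f hΦ => Subtype.ext ?_
    have hfix : f.1 ∈ fixedVectors (cInd (ZK k) Ξ) (congruenceSubgroup k n) :=
      fun u hu => f.2 u (hn hu)
    refine hΞ.eq_zero_of_forall_le_diagPow_mul_toGL hN hfix fun j hj κ => ?_
    rw [← cInd_apply_mul_toGL_eq hfix (hlift (reduction k n κ))]
    exact congrFun hΦ (⟨j, Nat.lt_succ_of_le hj⟩, reduction k n κ)

variable (hchar : (ringChar k : C) ≠ 0)
include hchar

omit hN in
lemma exists_fixed_mem_subrepresentation (σ : Subrepresentation (cInd (ZK k) Ξ))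
    {f : cIndSpace (ZK k) Ξ} (hf : f ∈ σ) (hf1 : f.1 1 ≠ 0) :
    ∃ f' ∈ σ, f' ∈ fixedVectors (cInd (ZK k) Ξ) (congruenceSubgroup k m) ∧ f'.1 1 ≠ 0 := by
  obtain ⟨n, hn⟩ := exists_mem_fixedVectors_congruenceSubgroup isSmooth_cInd f
  let S : Subgroup (GL (Fin 2) k⟦X⟧) := (reduction k m).ker
  let T : Subgroup S := ((reduction k n).comp S.subtype).ker
  let π : Representation C S (cIndSpace (ZK k) Ξ) := (cInd (ZK k) Ξ).comp ((toGL k).comp S.subtype)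
  have : Finite (S ⧸ T) := Finite.of_injective _
    (QuotientGroup.kerLift_injective ((reduction k n).comp S.subtype))
  have := Fintype.ofFinite (S ⧸ T)
  have hT : T ≤ vectorStabilizer π f := fun t ht => hn _ ⟨t.1, ht, rfl⟩
  refine ⟨cosetSum π T f, cosetSum_mem fun s => σ.apply_mem_toSubmodule _ hf, ?_, ?_⟩
  · rintro _ ⟨κ, hκ, rfl⟩
    exact apply_cosetSum hT ⟨κ, hκ⟩
  · let ev : cIndSpace (ZK k) Ξ →ₗ[C] W := (LinearMap.proj 1).comp (Submodule.subtype _)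
    have hev (s : S) : ev (π s f) = ev f := by
      change f.1 (1 * toGL k s) = f.1 1
      rw [one_mul, ← mul_one (toGL k s), hΞ.cInd_toGL_mul, MonoidHom.mem_ker.1 s.2, map_one,
        Module.End.one_apply]
    change ev (cosetSum π T f) ≠ 0
    rw [map_cosetSum hev]
    exact smul_ne_zero (index_ker_reduction_ne_zero hchar m n) hf1

theorem cInd_isIrreducible (hξ : ξ.IsIrreducible) : (cInd (ZK k) Ξ).IsIrreducible := by
  refine cInd_isIrreducible_of_exists_forall_notMem isOpen_ZK hΞ.isSmooth (hΞ.isIrreducible hξ)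
    fun σ f hf hf1 => ?_
  obtain ⟨f', hf', hfix, hf'1⟩ := hΞ.exists_fixed_mem_subrepresentation hchar σ hf hf1
  exact ⟨f', hf', hf'1, fun g hg => hΞ.cInd_eq_zero_of_notMem_ZK hN hfix hg⟩

lemma single_mem_jacquetKernel (w : W) : hΞ.single w ∈ jacquetKernel (cInd (ZK k) Ξ) := by
  have := Fintype.ofFinite (TruncRing k m)
  let u (y : TruncRing k m) : FiniteLevel k m :=
    upperRightHom (Ideal.Quotient.mk _ (PowerSeries.X ^ m : k⟦X⟧) * y)
  have hmem (y : TruncRing k m) :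
      hΞ.single (ξ (u y) w) - hΞ.single w ∈ jacquetKernel (cInd (ZK k) Ξ) := by
    obtain ⟨z, rfl⟩ := Ideal.Quotient.mk_surjective y
    refine Submodule.subset_span ⟨ιO (PowerSeries.X ^ m * z), hΞ.single w, ?_⟩
    rw [← toGL_upperRightHom, hΞ.cInd_toGL_single, reduction_upperRightHom, RingHom.map_mul]
  have hsum : ∑ y, (hΞ.single (ξ (u y) w) - hΞ.single w) =
      -((Nat.card (TruncRing k m) : C) • hΞ.single w) := by
    rw [Finset.sum_sub_distrib, ← map_sum, sum_upperRightHom_eq_zero hN, map_zero, zero_sub,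
      Finset.sum_const, Nat.cast_smul_eq_nsmul, Nat.card_eq_fintype_card, Finset.card_univ]
  rw [← Submodule.smul_mem_iff _ (natCast_card_ne_zero hchar (TruncRing k m)),
    ← Submodule.neg_mem_iff, ← hsum]
  exact Submodule.sum_mem _ fun y _ => hmem y

theorem cInd_isCuspidal (hξ : ξ.IsIrreducible) : IsCuspidal (cInd (ZK k) Ξ) where
  irreducible := hΞ.cInd_isIrreducible hN hchar hξ
  smooth := isSmooth_cInd
  jacquet := by
    have htop : (subrepSpan (cInd (ZK k) Ξ) (Set.range hΞ.single)).toSubmodule = ⊤ :=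
      congrArg (·.toSubmodule) (subrepSpan_cIndSingle_eq_top isOpen_ZK hΞ.isSmooth)
    rw [eq_top_iff, ← htop]
    refine Submodule.span_le.2 ?_
    rintro _ ⟨g, _, ⟨w, rfl⟩, rfl⟩
    obtain ⟨κ, hκ⟩ := exists_mul_toGL_apply_one_zero_eq_zero g
    have hg : cInd (ZK k) Ξ g (hΞ.single w) =
        cInd (ZK k) Ξ (g * toGL k κ) (hΞ.single (ξ (reduction k m κ⁻¹) w)) := by
      rw [← hΞ.cInd_toGL_single, ← Module.End.mul_apply, ← map_mul, map_inv,
        mul_inv_cancel_right]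
    rw [hg]
    exact apply_mem_jacquetKernel hκ (hΞ.single_mem_jacquetKernel hN hchar _)

end Finite

end IsInflation

end Inflation

/-! ### Lattice chains -/

section LineNilpotent

variable {R : Type*} [CommRing R]

/-- The square-zero matrix `w ↦ (v₀ w₁ - v₁ w₀) v`, whose image and kernel are the line of `v` when
`v` is unimodular. The unipotent subgroups conjugate to `N` are the groups of the matrices
`1 + x • lineNilpotent v`. -/
def lineNilpotent (v : Fin 2 → R) : Matrix (Fin 2) (Fin 2) R :=
  Matrix.vecMulVec v ![-v 1, v 0]

lemma lineNilpotent_mulVec (v w : Fin 2 → R) :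
    (lineNilpotent v).mulVec w = (v 0 * w 1 - v 1 * w 0) • v := by
  rw [lineNilpotent, Matrix.vecMulVec_mulVec, op_smul_eq_smul, Matrix.vec2_dotProduct]
  congr 1
  simp only [Matrix.cons_val_zero, Matrix.cons_val_one]
  ring

lemma map_lineNilpotent {S : Type*} [CommRing S] (f : R →+* S) (v : Fin 2 → R) :
    (lineNilpotent v).map f = lineNilpotent (f ∘ v) := by
  ext i j
  fin_cases j <;> simp [lineNilpotent, Matrix.vecMulVec_apply]

lemma conj_upperRightHom_of_det_eq_one {κ : GL (Fin 2) R} (hκ : κ.1.det = 1) (x : R) :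
    (κ * upperRightHom x * κ⁻¹).1 = 1 + x • lineNilpotent fun i => κ i 0 := by
  rw [Matrix.det_fin_two] at hκ
  have h : (κ * upperRightHom x).1 = (1 + x • lineNilpotent fun i => κ i 0) * κ.1 := by
    ext i j
    fin_cases i <;> fin_cases j <;>
      simp [lineNilpotent, Matrix.mul_apply, Fin.sum_univ_two]
    · ring
    · linear_combination (-x * κ 0 0) * hκ
    · ring
    · linear_combination (-x * κ 1 0) * hκ
  rw [Units.val_mul, h, mul_assoc, Units.mul_inv, mul_one]

end LineNilpotent

section StdChain

variable {k : Type*} [Field k]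

lemma mem_stdChain_L {i : ℤ} {v : Fin 2 → k⸨X⸩} :
    v ∈ (stdChain k).L i ↔ ∀ j, v j ∈ fracIdeal k i := by
  constructor
  · rintro ⟨w, rfl⟩ j
    exact ⟨w j, rfl⟩
  · intro h
    choose w hw using h
    exact ⟨w, (funext hw).symm⟩

lemma mem_stdChain_radPow {n : ℤ} {x : Matrix (Fin 2) (Fin 2) k⸨X⸩} :
    x ∈ (stdChain k).radPow n ↔ ∀ i j, x i j ∈ fracIdeal k n := by
  constructor
  · intro h i j
    have hj : Pi.single j 1 ∈ (stdChain k).L 0 :=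
      ⟨Pi.single j 1, funext fun l => by
        rcases eq_or_ne l j with rfl | hl <;> simp [scaleMap, *]⟩
    have hcol := mem_stdChain_L.1 (h 0 _ hj) i
    rwa [zero_add, Matrix.mulVec_single_one] at hcol
  · intro h i v hv
    rw [mem_stdChain_L] at hv ⊢
    intro j
    rw [Matrix.mulVec, dotProduct, add_comm]
    exact Submodule.sum_mem _ fun l _ => mul_mem_fracIdeal (h j l) (hv l)

lemma mem_stdChain_unitGroup {n : ℕ} (hn : 0 < n) {g : GL (Fin 2) k⸨X⸩} :
    g ∈ (stdChain k).unitGroup n ↔ ∃ B, toGL k (onePlus hn B) = g := by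
  rw [exists_toGL_onePlus_eq_iff]
  exact mem_stdChain_radPow

lemma mem_stdChain_unitGroup_succ {n : ℕ} {g : GL (Fin 2) k⸨X⸩} :
    g ∈ (stdChain k).unitGroup (n + 1) ↔ g ∈ congruenceSubgroup k n := by
  rw [mem_congruenceSubgroup]
  exact mem_stdChain_radPow

end StdChain

namespace LatticeChain

variable {k : Type*} [Field k] {Λ Λ' : LatticeChain k} {i n : ℤ} {v : Fin 2 → k⸨X⸩}
  {x : Matrix (Fin 2) (Fin 2) k⸨X⸩} {g : GL (Fin 2) k⸨X⸩}

lemma radPow_congr (h : Λ.L = Λ'.L) : Λ.radPow = Λ'.radPow := by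
  simp only [funext_iff, radPow, h, implies_true]

lemma unif_smul_mem_iff : unif k • v ∈ Λ.L (i + Λ.e) ↔ v ∈ Λ.L i := by
  have hX (w : Fin 2 → k⸨X⸩) : (PowerSeries.X : k⟦X⟧) • w = unif k • w :=
    (algebraMap_smul k⸨X⸩ (PowerSeries.X : k⟦X⟧) w).symm
  rw [← Λ.period, Submodule.mem_smul_pointwise_iff_exists]
  constructor
  · rintro ⟨w, hw, h⟩
    rw [hX] at h
    rwa [← smul_right_injective _ (unif_ne_zero k) h]
  · exact fun h => ⟨v, h, hX v⟩

lemma unif_zpow_smul_mem_iff (d : ℤ) : unif k ^ d • v ∈ Λ.L (i + d * Λ.e) ↔ v ∈ Λ.L i := by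
  have hsucc (d : ℤ) : unif k ^ (d + 1) • v ∈ Λ.L (i + (d + 1) * Λ.e) ↔
      unif k ^ d • v ∈ Λ.L (i + d * Λ.e) := by
    rw [add_comm d, zpow_one_add₀ (unif_ne_zero k), mul_smul, add_comm 1, add_one_mul, ← add_assoc,
      unif_smul_mem_iff]
  induction d with
  | zero => simp
  | succ d ih => exact (hsucc d).trans ih
  | pred d ih => exact (hsucc _).symm.trans (by rwa [sub_add_cancel])

lemma e_pos (Λ : LatticeChain k) : 0 < Λ.e := by
  rw [Nat.pos_iff_ne_zero]
  intro he
  have hp : (PowerSeries.X : k⟦X⟧) • Λ.L 0 = Λ.L 0 := by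
    rw [Λ.period, he, Nat.cast_zero, add_zero]
  have hbot : Λ.L 0 = ⊥ := by
    refine Submodule.eq_bot_of_le_smul_of_le_jacobson_bot
      (Ideal.span {(PowerSeries.X : k⟦X⟧)}) _ (Λ.isLattice 0).fg ?_ ?_
    · rw [Submodule.ideal_span_singleton_smul, hp]
    · rw [IsLocalRing.jacobson_eq_maximalIdeal _ bot_ne_top, PowerSeries.maximalIdeal_eq_span_X]
  exact (bot_le.trans_lt (Λ.strictAnti zero_lt_one)).ne' hbot

/-- Translation of a lattice chain by an element of `GL₂(F)`. -/
noncomputable instance : SMul (GL (Fin 2) k⸨X⸩) (LatticeChain k) where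
  smul g Λ :=
    { L := fun i => (Λ.L i).map ((Matrix.mulVecLin g.1).restrictScalars k⟦X⟧)
      isLattice := fun i =>
        { fg := (Λ.isLattice i).fg.map _
          span_eq_top := by
            rw [Submodule.map_coe, LinearMap.coe_restrictScalars, Submodule.span_image,
              (Λ.isLattice i).span_eq_top, Submodule.map_top, LinearMap.range_eq_top]
            exact Matrix.mulVec_surjective_iff_isUnit.2 g.isUnit }
      strictAnti := (Submodule.map_strictMono_of_injective
        (Matrix.mulVec_injective_iff_isUnit.2 g.isUnit)).comp_strictAnti Λ.strictAnti
      e := Λ.e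
      period := fun i => by rw [← Λ.period, Submodule.map_pointwise_smul] }

lemma inv_mulVec_mulVec (g : GL (Fin 2) k⸨X⸩) (v : Fin 2 → k⸨X⸩) :
    g⁻¹.1.mulVec (g.1.mulVec v) = v := by
  rw [Matrix.mulVec_mulVec, Units.inv_mul, Matrix.one_mulVec]

lemma mulVec_inv_mulVec (g : GL (Fin 2) k⸨X⸩) (v : Fin 2 → k⸨X⸩) :
    g.1.mulVec (g⁻¹.1.mulVec v) = v := by
  rw [Matrix.mulVec_mulVec, Units.mul_inv, Matrix.one_mulVec]

lemma mem_smul_L : v ∈ (g • Λ).L i ↔ g⁻¹.1.mulVec v ∈ Λ.L i := by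
  constructor
  · rintro ⟨w, hw, rfl⟩
    exact (inv_mulVec_mulVec g w).symm ▸ hw
  · exact fun h => ⟨_, h, mulVec_inv_mulVec g v⟩

lemma mem_smul_radPow : x ∈ (g • Λ).radPow n ↔ g⁻¹.1 * x * g.1 ∈ Λ.radPow n := by
  constructor
  · intro h i v hv
    have hgv : g.1.mulVec v ∈ (g • Λ).L i :=
      mem_smul_L.2 (by rwa [inv_mulVec_mulVec])
    have hx := mem_smul_L.1 (h i _ hgv)
    rwa [Matrix.mulVec_mulVec, Matrix.mulVec_mulVec] at hx
  · intro h i v hv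
    have hx := h i _ (mem_smul_L.1 hv)
    rwa [Matrix.mulVec_mulVec, mul_assoc, Units.mul_inv, mul_one, ← Matrix.mulVec_mulVec,
      ← mem_smul_L] at hx

lemma mem_smul_unitGroup {n : ℕ} {u : GL (Fin 2) k⸨X⸩} :
    u ∈ (g • Λ).unitGroup n ↔ g⁻¹ * u * g ∈ Λ.unitGroup n := by
  refine mem_smul_radPow.trans (iff_of_eq (congrArg (· ∈ Λ.radPow n) ?_))
  rw [mul_sub, sub_mul, mul_one, Units.inv_mul, Units.val_mul, Units.val_mul]

lemma exists_smul_L_zero_eq (Λ : LatticeChain k) :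
    ∃ γ : GL (Fin 2) k⸨X⸩, (γ • Λ).L 0 = (stdChain k).L 0 := by
  have := Λ.isLattice 0
  have hfree : Module.Free k⟦X⟧ (Λ.L 0) := Submodule.IsLattice.free k⸨X⸩ _
  have hrank : Module.finrank k⟦X⟧ (Λ.L 0) = 2 := by
    rw [Submodule.IsLattice.finrank_of_pi k⸨X⸩ (Λ.L 0), Fintype.card_fin]
  let b := Module.finBasisOfFinrankEq _ _ hrank
  let b' := b.extendOfIsLattice k⸨X⸩
  have hb' (j) : b' j = b j := b.extendOfIsLattice_apply k⸨X⸩ j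
  have hspan : Λ.L 0 = Submodule.span k⟦X⟧ (Set.range b') := by
    rw [show ⇑b' = (Λ.L 0).subtype ∘ b from funext hb', Set.range_comp, Submodule.span_image,
      b.span_eq, Submodule.map_top, Submodule.range_subtype]
  let γ := Matrix.GeneralLinearGroup.toLin.symm (.ofLinearEquiv b'.equivFun)
  have hγ (v) : γ.1.mulVec v = b'.equivFun v := by
    rw [← Matrix.mulVecLin_apply, ← Matrix.GeneralLinearGroup.toLin_apply,
      MulEquiv.apply_symm_apply]
    rfl
  refine ⟨γ, Submodule.ext fun v => ?_⟩
  rw [mem_smul_L, hspan, b'.mem_span_iff_repr_mem k⟦X⟧, mem_stdChain_L]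
  refine forall_congr' fun j => ?_
  rw [← b'.equivFun_apply, ← hγ, mulVec_inv_mulVec, mem_fracIdeal_zero]
  exact exists_congr fun _ => eq_comm

lemma exists_smul_radPow_eq (he : Λ.e = 1) :
    ∃ γ : GL (Fin 2) k⸨X⸩, (γ • Λ).radPow = (stdChain k).radPow := by
  obtain ⟨γ, hγ⟩ := Λ.exists_smul_L_zero_eq
  have he' : (γ • Λ).e = (stdChain k).e := he
  refine ⟨γ, radPow_congr (funext fun i => Submodule.ext fun v => ?_)⟩
  rw [← unif_zpow_smul_mem_iff (-i), ← unif_zpow_smul_mem_iff (Λ := stdChain k) (-i), he',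
    show i + -i * ((stdChain k).e : ℤ) = 0 by simp [stdChain], hγ]

section PeriodLeTwo

/-- The subspace of `k²` consisting of the constant vectors in `L_i`. -/
noncomputable def residueSpace (Λ : LatticeChain k) (i : ℤ) : Submodule k (Fin 2 → k) where
  carrier := {c | (fun j => ιO (PowerSeries.C (c j))) ∈ Λ.L i}
  zero_mem' := by
    simp only [Set.mem_ofPred_eq, Pi.zero_apply, map_zero]
    exact Submodule.zero_mem _
  add_mem' ha hb := by
    simp only [Set.mem_ofPred_eq, Pi.add_apply, map_add] at ha hb ⊢
    exact Submodule.add_mem _ ha hb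
  smul_mem' r c hc := by
    simp only [Set.mem_ofPred_eq, Pi.smul_apply, smul_eq_mul, map_mul] at hc ⊢
    convert Submodule.smul_mem _ (PowerSeries.C r) hc using 1
    exact funext fun j => (Algebra.smul_def _ _).symm

lemma residueSpace_succ_lt (h0 : Λ.L 0 = (stdChain k).L 0) (hi : 0 ≤ i) (hie : i < Λ.e) :
    Λ.residueSpace (i + 1) < Λ.residueSpace i := by
  refine SetLike.lt_iff_le_and_exists.2 ⟨fun c hc => Λ.strictAnti.antitone (by omega) hc, ?_⟩
  obtain ⟨v, hv, hv'⟩ := SetLike.exists_of_lt (Λ.strictAnti (lt_add_one i))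
  have hv0 := h0 ▸ Λ.strictAnti.antitone hi hv
  choose w hw using fun j => mem_fracIdeal_zero.1 (mem_stdChain_L.1 hv0 j)
  let c (j : Fin 2) : k := PowerSeries.constantCoeff (w j)
  have hdiff : v - (fun j => ιO (PowerSeries.C (c j))) ∈ Λ.L (i + 1) := by
    refine Λ.strictAnti.antitone (show i + 1 ≤ 0 + Λ.e by omega) ?_
    choose d hd using fun j => PowerSeries.X_dvd_iff.2
      (show PowerSeries.constantCoeff (w j - PowerSeries.C (c j)) = 0 by simp [c])
    have hdL : (fun j => ιO (d j)) ∈ Λ.L 0 :=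
      h0 ▸ mem_stdChain_L.2 fun j => mem_fracIdeal_zero.2 ⟨d j, rfl⟩
    convert unif_smul_mem_iff.2 hdL using 1
    refine funext fun j => ?_
    rw [Pi.sub_apply, hw, ← map_sub, hd, map_mul, Pi.smul_apply, smul_eq_mul, unif]
  refine ⟨c, ?_, fun hc => hv' ?_⟩
  · exact (Submodule.sub_mem_iff_right _ hv).1 (Λ.strictAnti.antitone (by omega) hdiff)
  · exact (Submodule.sub_mem_iff_left (Λ.L (i + 1)) hc).1 hdiff

lemma e_le_two (Λ : LatticeChain k) : Λ.e ≤ 2 := by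
  obtain ⟨γ, h0⟩ := Λ.exists_smul_L_zero_eq
  have hrank (i : ℕ) (hi : i ≤ Λ.e) :
      Module.finrank k ((γ • Λ).residueSpace i) + i ≤ 2 := by
    induction i with
    | zero => simpa using Submodule.finrank_le ((γ • Λ).residueSpace 0)
    | succ i ih =>
      have hlt := Submodule.finrank_lt_finrank_of_lt
        (residueSpace_succ_lt h0 (Int.natCast_nonneg i) (Int.ofNat_lt.2 hi))
      have := ih (by omega)
      push_cast
      omega
  exact le_of_add_le_right (hrank Λ.e le_rfl)

end PeriodLeTwo

section Nilpotent

lemma exists_le_stdChain_L (Λ : LatticeChain k) (i : ℤ) : ∃ N, Λ.L i ≤ (stdChain k).L N := by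
  obtain ⟨s, hs⟩ := (Λ.isLattice i).fg
  choose N hN using fun (v : Fin 2 → k⸨X⸩) (j : Fin 2) => exists_mem_fracIdeal (v j)
  obtain ⟨M, hM⟩ := (s.image₂ N Finset.univ).bddBelow
  refine ⟨M, hs ▸ Submodule.span_le.2 fun v hv => mem_stdChain_L.2 fun j => ?_⟩
  have hle : M ≤ N v j := hM (Finset.mem_coe.2 (Finset.mem_image₂_of_mem hv (Finset.mem_univ j)))
  exact fracIdeal_antitone hle (hN v j)

lemma exists_not_le_stdChain_L (Λ : LatticeChain k) : ∃ i, ¬ Λ.L i ≤ (stdChain k).L 1 := by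
  obtain ⟨v, hv, hv1⟩ := SetLike.exists_of_lt (Λ.strictAnti zero_lt_one)
  obtain ⟨j, hj⟩ := Function.ne_iff.1 (show v ≠ 0 from fun h => hv1 (h ▸ Submodule.zero_mem _))
  obtain ⟨n, u, hu⟩ := exists_eq_unif_zpow_mul_unit hj
  refine ⟨0 + -n * Λ.e, fun hle => ?_⟩
  have hmem := mem_stdChain_L.1 (hle ((unif_zpow_smul_mem_iff (-n)).2 hv)) j
  rw [Pi.smul_apply, hu, smul_eq_mul, ← mul_assoc, ← zpow_add₀ (unif_ne_zero k), neg_add_cancel,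
    zpow_zero, one_mul, algebraMap_mem_fracIdeal_one] at hmem
  exact (u.isUnit.map PowerSeries.constantCoeff).ne_zero hmem

lemma exists_last_not_le_stdChain_L (Λ : LatticeChain k) :
    ∃ i, ¬ Λ.L i ≤ (stdChain k).L 1 ∧ Λ.L (i + 1) ≤ (stdChain k).L 1 := by
  obtain ⟨N, hN⟩ := Λ.exists_le_stdChain_L 0
  have hbdd (i : ℤ) (hi : ¬ Λ.L i ≤ (stdChain k).L 1) : i ≤ (1 - N) * Λ.e := by
    contrapose! hi
    intro v hv
    have hv0 : unif k ^ (-(1 - N)) • v ∈ Λ.L 0 := by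
      rw [← unif_zpow_smul_mem_iff (1 - N), smul_smul, ← zpow_add₀ (unif_ne_zero k),
        add_neg_cancel, zpow_zero, one_smul, zero_add]
      exact Λ.strictAnti.antitone hi.le hv
    rw [mem_stdChain_L]
    intro j
    have hj := mem_stdChain_L.1 (hN hv0) j
    rw [Pi.smul_apply, smul_eq_mul, unif_zpow_mul_mem_fracIdeal] at hj
    convert hj using 2
    ring
  obtain ⟨i, hi, hmax⟩ := Int.exists_greatest_of_bdd ⟨_, hbdd⟩ Λ.exists_not_le_stdChain_L
  exact ⟨i, hi, not_not.1 fun h => (lt_add_one i).not_ge (hmax _ h)⟩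

lemma radPow_antitone (Λ : LatticeChain k) : Antitone Λ.radPow :=
  fun _ _ h _ hx i v hv => Λ.strictAnti.antitone (by omega) (hx i v hv)

lemma algebraMap_smul_mem_radPow (y : k⟦X⟧) (hx : x ∈ Λ.radPow n) :
    (ιO y : k⸨X⸩) • x ∈ Λ.radPow n := by
  intro i v hv
  rw [Matrix.smul_mulVec, algebraMap_smul]
  exact Submodule.smul_mem _ _ (hx i v hv)

lemma unif_zpow_smul_mem_radPow (d : ℤ) (hx : x ∈ Λ.radPow n) :
    unif k ^ d • x ∈ Λ.radPow (n + d * Λ.e) := by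
  intro i v hv
  rw [Matrix.smul_mulVec, ← add_assoc, unif_zpow_smul_mem_iff]
  exact hx i v hv

lemma mem_radPow_of_forall_window (i₀ : ℤ)
    (h : ∀ i ≤ i₀, i₀ < i + Λ.e → ∀ v ∈ Λ.L i, x.mulVec v ∈ Λ.L (i + n)) : x ∈ Λ.radPow n := by
  intro i v hv
  have he : (0 : ℤ) < Λ.e := Int.natCast_pos.2 Λ.e_pos
  have hle := Int.ediv_mul_le (i₀ - i) he.ne'
  have hlt := Int.lt_ediv_add_one_mul_self (i₀ - i) he
  rw [add_one_mul] at hlt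
  rw [← unif_zpow_smul_mem_iff ((i₀ - i) / Λ.e)] at hv ⊢
  rw [← Matrix.mulVec_smul, add_right_comm]
  exact h _ (by omega) (by omega) _ hv

lemma exists_lineNilpotent_mem_radPow (Λ : LatticeChain k) :
    ∃ v : Fin 2 → k⟦X⟧, IsCoprime (v 0) (v 1) ∧ (lineNilpotent v).map ιO ∈ Λ.radPow 0 := by
  obtain ⟨i₀, hi₀, hlast⟩ := Λ.exists_last_not_le_stdChain_L
  have hint (i : ℤ) (hi : i₀ < i + Λ.e) (w : Fin 2 → k⸨X⸩) (hw : w ∈ Λ.L i) :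
      ∃ y : Fin 2 → k⟦X⟧, w = ιO ∘ y := by
    have hw1 := mem_stdChain_L.1
      (hlast (Λ.strictAnti.antitone (Int.add_one_le_iff.2 hi) (unif_smul_mem_iff.2 hw)))
    have hw0 (j) : ∃ y : k⟦X⟧, w j = ιO y := by
      rw [← mem_fracIdeal_zero, ← sub_self (1 : ℤ), ← unif_zpow_mul_mem_fracIdeal, zpow_one]
      exact hw1 j
    choose y hy using hw0
    exact ⟨y, funext hy⟩
  obtain ⟨v₀, hv₀, hv₀1⟩ := SetLike.not_le_iff_exists.1 hi₀
  obtain ⟨v, rfl⟩ := hint i₀ (by have := Λ.e_pos; omega) v₀ hv₀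
  obtain ⟨j, hj⟩ := not_forall.1 (mt mem_stdChain_L.2 hv₀1)
  rw [Function.comp_apply, algebraMap_mem_fracIdeal_one] at hj
  have hunit : IsUnit (v j) := PowerSeries.isUnit_iff_constantCoeff.2 (Ne.isUnit hj)
  refine ⟨v, ?_, mem_radPow_of_forall_window i₀ fun i hi hi' w hw => ?_⟩
  · fin_cases j
    exacts [isCoprime_one_left.of_isCoprime_of_dvd_left hunit.dvd,
      isCoprime_one_right.of_isCoprime_of_dvd_right hunit.dvd]
  · obtain ⟨y, rfl⟩ := hint i hi' w hw
    rw [map_lineNilpotent, lineNilpotent_mulVec]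
    simp only [Function.comp_apply]
    rw [← map_mul, ← map_mul, ← map_sub, algebraMap_smul, add_zero]
    exact Λ.strictAnti.antitone hi (Submodule.smul_mem _ _ hv₀)

lemma exists_conj_mem_unitGroup (Λ : LatticeChain k) :
    ∃ κ : GL (Fin 2) k⟦X⟧, ∀ m n : ℕ, n ≤ m * Λ.e → ∀ y : k⟦X⟧,
      toGL k (κ * upperRightHom (PowerSeries.X ^ m * y) * κ⁻¹) ∈ Λ.unitGroup n := by
  obtain ⟨v, hv, hvΛ⟩ := Λ.exists_lineNilpotent_mem_radPow
  obtain ⟨κ, hκ, hcol⟩ := exists_GL_firstColumn hv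
  refine ⟨κ, fun m n hn y => ?_⟩
  have hmat : (toGL k (κ * upperRightHom (PowerSeries.X ^ m * y) * κ⁻¹)).1 - 1 =
      unif k ^ (m : ℤ) • (ιO y : k⸨X⸩) • (lineNilpotent v).map ιO := by
    rw [coe_toGL, conj_upperRightHom_of_det_eq_one hκ, funext hcol, ← RingHom.mapMatrix_apply,
      map_add, map_one, add_sub_cancel_left, RingHom.mapMatrix_apply,
      Matrix.map_smul' _ _ _ (map_mul _), map_mul, algebraMap_X_pow, mul_smul]
  rw [unitGroup, Set.mem_ofPred_eq, hmat]
  refine Λ.radPow_antitone ?_ (unif_zpow_smul_mem_radPow m (algebraMap_smul_mem_radPow y hvΛ))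
  rw [zero_add]
  exact_mod_cast hn

end Nilpotent

end LatticeChain

/-! ### Levels -/

section Det

variable {F : Type*} [CommRing F]

lemma det_upperRightHom (x : F) : Matrix.GeneralLinearGroup.det (upperRightHom x) = 1 :=
  Units.ext (by simp [Matrix.det_fin_two])

end Det

section Level

variable {k C V : Type*} [Field k] [Field C] [AddCommGroup V] [Module C V]
  {π : Representation C (GL (Fin 2) k⸨X⸩) V} {Λ : LatticeChain k} {n : ℕ}

lemma apply_eq_smul_of_mem_smul_unitGroup {θ : GL (Fin 2) k⸨X⸩ → C} {v : V}
    (hv : ∀ u ∈ Λ.unitGroup n, π u v = θ u • v) {g u : GL (Fin 2) k⸨X⸩}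
    (hu : u ∈ (g • Λ).unitGroup n) : π u (π g v) = θ (g⁻¹ * u * g) • π g v := by
  rw [← map_smul, ← hv _ (LatticeChain.mem_smul_unitGroup.1 hu), ← Module.End.mul_apply,
    ← Module.End.mul_apply, ← map_mul, ← map_mul]
  group

lemma exists_hasLevel_of_containsCharOn (h : ContainsCharOn π (Λ.unitGroup (n + 1)) fun _ => 1) :
    ∃ r, HasLevel π r := by
  classical
  set S := {x : ℚ | ∃ (Λ : LatticeChain k) (n : ℕ),
    ContainsCharOn π (Λ.unitGroup (n + 1)) (fun _ => 1) ∧ x = (n : ℚ) / (Λ.e : ℚ)}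
  have hhalf (x) (hx : x ∈ S) : ∃ a : ℕ, x = (a : ℚ) / 2 := by
    obtain ⟨Λ, n, -, rfl⟩ := hx
    have hpos := Λ.e_pos
    have hle := Λ.e_le_two
    interval_cases Λ.e
    · exact ⟨2 * n, by push_cast; ring⟩
    · exact ⟨n, by norm_num⟩
  have hex : ∃ a : ℕ, (a : ℚ) / 2 ∈ S := by
    obtain ⟨a, ha⟩ := hhalf _ ⟨Λ, n, h, rfl⟩
    exact ⟨a, ha ▸ ⟨Λ, n, h, rfl⟩⟩
  refine ⟨(Nat.find hex : ℚ) / 2, Nat.find_spec hex, fun x hx => ?_⟩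
  obtain ⟨a, rfl⟩ := hhalf x hx
  gcongr
  exact Nat.find_min' hex hx

theorem exists_hasLevel [Nontrivial V] (hπ : IsSmooth π) : ∃ r, HasLevel π r := by
  obtain ⟨v, hv⟩ := exists_ne (0 : V)
  obtain ⟨n, hn⟩ := exists_mem_fixedVectors_congruenceSubgroup hπ v
  refine exists_hasLevel_of_containsCharOn (Λ := stdChain k) (n := n) ⟨v, hv, fun u hu => ?_⟩
  rw [hn u (mem_stdChain_unitGroup_succ.1 hu), one_smul]

lemma isSmooth_twist (hπ : IsSmooth π) {φ : k⸨X⸩ˣ →* Cˣ} (hφ : IsOpen (φ.ker : Set k⸨X⸩ˣ)) :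
    IsSmooth (twist φ π) := by
  intro v
  have hopen : IsOpen ((vectorStabilizer π v ⊓ φ.ker.comap Matrix.GeneralLinearGroup.det :
      Subgroup (GL (Fin 2) k⸨X⸩)) : Set (GL (Fin 2) k⸨X⸩)) :=
    (hπ v).inter (hφ.preimage Matrix.GeneralLinearGroup.continuous_det)
  refine Subgroup.isOpen_mono (H₂ := vectorStabilizer (twist φ π) v) (fun g hg => ?_) hopen
  obtain ⟨hgv, hgφ⟩ := Subgroup.mem_inf.1 hg
  rw [mem_vectorStabilizer] at hgv ⊢
  change (φ (Matrix.GeneralLinearGroup.det g) : C) • π g v = v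
  rw [MonoidHom.mem_ker.1 (Subgroup.mem_comap.1 hgφ), Units.val_one, one_smul, hgv]

end Level

section InflationLevel

variable {k C W : Type*} [Field k] [Field C] [AddCommGroup W] [Module C W] {m : ℕ}
  {ξ : Representation C (FiniteLevel k m) W} {Ξ : Representation C (ZK k) W}

lemma eq_zero_of_forall_conj_upperRightHom
    (hN : ¬ ContainsCharOn ξ (unipFiltration k m m) (fun _ => 1)) (κ : GL (Fin 2) k⟦X⟧) {w : W}
    (hw : ∀ y, ξ (reduction k m (κ * upperRightHom (PowerSeries.X ^ m * y) * κ⁻¹)) w = w) :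
    w = 0 := by
  have hzero : ξ (reduction k m κ⁻¹) w = 0 := eq_zero_of_forall_upperRightHom hN fun y => by
    conv_rhs => rw [← hw y]
    rw [← Module.End.mul_apply, ← Module.End.mul_apply, ← map_mul, ← map_mul, ← map_mul, ← map_mul]
    group
  have happly := congrArg (ξ (reduction k m κ)) hzero
  rwa [← Module.End.mul_apply, ← map_mul, ← map_mul, mul_inv_cancel, map_one, map_one,
    Module.End.one_apply, map_zero] at happly

namespace IsInflation

variable (hΞ : IsInflation ξ Ξ)
include hΞ

lemma single_mem_fixedVectors (w : W) :
    hΞ.single w ∈ fixedVectors (cInd (ZK k) Ξ) (congruenceSubgroup k m) := by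
  rintro _ ⟨κ, hκ, rfl⟩
  rw [cInd_toGL_single, MonoidHom.mem_ker.1 hκ, map_one, Module.End.one_apply]

variable (hN : ¬ ContainsCharOn ξ (unipFiltration k m m) (fun _ => 1))
include hN

lemma le_of_containsCharOn {Λ : LatticeChain k} {n : ℕ} {θ : GL (Fin 2) k⸨X⸩ → C}
    (hθ : ∀ u, Matrix.GeneralLinearGroup.det u = 1 → θ u = 1)
    (h : ContainsCharOn (cInd (ZK k) Ξ) (Λ.unitGroup (n + 1)) θ) : m * Λ.e ≤ n := by
  by_contra! hlt
  obtain ⟨f, hf0, hf⟩ := h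
  refine hf0 (Subtype.ext (funext fun g => ?_))
  obtain ⟨κ, hκ⟩ := (g • Λ).exists_conj_mem_unitGroup
  refine eq_zero_of_forall_conj_upperRightHom hN κ fun y => ?_
  have hdet : θ (g⁻¹ * toGL k (κ * upperRightHom (PowerSeries.X ^ m * y) * κ⁻¹) * g) = 1 :=
    hθ _ (by simp only [map_mul, map_inv, toGL_upperRightHom, det_upperRightHom, mul_one,
      mul_inv_cancel, inv_mul_cancel])
  have hfix := apply_eq_smul_of_mem_smul_unitGroup hf (hκ m (n + 1) hlt y)
  rw [hdet, one_smul] at hfix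
  have hval := congrFun (congrArg Subtype.val hfix) 1
  rw [cInd_apply, cInd_apply, cInd_apply, one_mul, one_mul] at hval
  rw [← hΞ.cInd_toGL_mul, hval]

theorem cInd_hasLevel [Nontrivial W] : HasLevel (cInd (ZK k) Ξ) m := by
  obtain ⟨w, hw⟩ := exists_ne (0 : W)
  have hw' : hΞ.single w ≠ 0 := (map_ne_zero_iff _ (cIndSingle_injective _ _)).2 hw
  refine ⟨⟨stdChain k, m, ⟨hΞ.single w, hw', fun u hu => ?_⟩, by simp [stdChain]⟩, ?_⟩
  · rw [one_smul, hΞ.single_mem_fixedVectors w u (mem_stdChain_unitGroup_succ.1 hu)]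
  · rintro _ ⟨Λ, n, h, rfl⟩
    rw [le_div_iff₀ (Nat.cast_pos.2 Λ.e_pos)]
    exact_mod_cast hΞ.le_of_containsCharOn hN (fun _ _ => rfl) h

lemma le_of_hasLevel_twist {φ : k⸨X⸩ˣ →* Cˣ} {r : ℚ} (hr : HasLevel (twist φ (cInd (ZK k) Ξ)) r) :
    (m : ℚ) ≤ r := by
  obtain ⟨Λ, n, ⟨f, hf0, hf⟩, rfl⟩ := hr.1
  have h : ContainsCharOn (cInd (ZK k) Ξ) (Λ.unitGroup (n + 1))
      fun u => ((φ (Matrix.GeneralLinearGroup.det u))⁻¹ : Cˣ) := by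
    refine ⟨f, hf0, fun u hu => ?_⟩
    have hu' : (φ (Matrix.GeneralLinearGroup.det u) : C) • cInd (ZK k) Ξ u f = (1 : C) • f :=
      hf u hu
    rw [one_smul] at hu'
    rw [← hu', smul_smul, Units.inv_mul, one_smul, hu']
  rw [le_div_iff₀ (Nat.cast_pos.2 Λ.e_pos)]
  exact_mod_cast hΞ.le_of_containsCharOn hN (fun u hu => by simp [hu]) h

theorem exists_hasLevel_twist [Nontrivial W] {φ : k⸨X⸩ˣ →* Cˣ}
    (hφ : IsOpen (φ.ker : Set k⸨X⸩ˣ)) :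
    ∃ r : ℚ, HasLevel (twist φ (cInd (ZK k) Ξ)) r ∧ (m : ℚ) ≤ r := by
  have : Nontrivial (cIndSpace (ZK k) Ξ) := (cIndSingle_injective isOpen_ZK hΞ.isSmooth).nontrivial
  obtain ⟨r, hr⟩ := exists_hasLevel (isSmooth_twist (isSmooth_cInd (H := ZK k) (ρ := Ξ)) hφ)
  exact ⟨r, hr, hΞ.le_of_hasLevel_twist hN hr⟩

end IsInflation

end InflationLevel

/-! ### The last layer -/

section Trace

variable {R : Type*} [CommRing R]

lemma trace_mul_lineNilpotent_eq_zero {a : Matrix (Fin 2) (Fin 2) R} {v : Fin 2 → R} {l : R}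
    (h : a.mulVec v = l • v) : (a * lineNilpotent v).trace = 0 := by
  rw [lineNilpotent, Matrix.mul_vecMulVec, h, Matrix.trace_vecMulVec, Matrix.vec2_dotProduct]
  simp only [Pi.smul_apply, smul_eq_mul, Matrix.cons_val_zero, Matrix.cons_val_one]
  ring

lemma sum_addChar_trace_mul_eq_zero {k n : Type*} [Field k] [Fintype k] [Fintype n]
    [DecidableEq n] [IsDomain R] {χ : AddChar k R} (hχ : χ ≠ 1) {A : Matrix n n k} (hA : A ≠ 0) :
    ∑ a : Matrix n n k, χ (a * A).trace = 0 := by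
  let traceMul : Matrix n n k →+ k :=
    (Matrix.traceAddMonoidHom n k).comp (AddMonoidHom.mulRight A)
  have hsurj : Function.Surjective traceMul := fun x => by
    obtain ⟨i, j, hij⟩ : ∃ i j, A i j ≠ 0 := by
      contrapose! hA
      exact Matrix.ext hA
    refine ⟨Matrix.single j i (x / A i j), ?_⟩
    change (Matrix.single j i (x / A i j) * A).trace = x
    rw [Matrix.trace_single_mul, smul_eq_mul, div_mul_cancel₀ _ hij]
  refine AddChar.sum_eq_zero_of_ne_one (ψ := χ.compAddMonoidHom traceMul) fun h => hχ ?_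
  ext x
  obtain ⟨a, rfl⟩ := hsurj x
  exact DFunLike.congr_fun h a

end Trace

section LastLayer

variable {k : Type*} [Field k] {m : ℕ}

/-- The element `1 + t^m A` of the last layer of `GL₂(O_F / t^(m+1))`, for a matrix `A` over `k`. -/
noncomputable def lastLayer (hm : 0 < m) (A : Matrix (Fin 2) (Fin 2) k) : FiniteLevel k m :=
  reduction k m (onePlus hm (A.map PowerSeries.C))

lemma reduction_onePlus_eq_lastLayer (hm : 0 < m) (B : Matrix (Fin 2) (Fin 2) k⟦X⟧) :
    reduction k m (onePlus hm B) = lastLayer hm (B.map PowerSeries.constantCoeff) := by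
  rw [lastLayer, reduction_eq_iff]
  intro i j
  rw [coe_onePlus, coe_onePlus, Matrix.add_apply, Matrix.add_apply, add_sub_add_left_eq_sub,
    Matrix.smul_apply, Matrix.smul_apply, ← smul_sub, smul_eq_mul, pow_succ]
  exact mul_dvd_mul_left _ (PowerSeries.X_dvd_iff.2 (by simp))

lemma lastLayer_zero (hm : 0 < m) : lastLayer hm (0 : Matrix (Fin 2) (Fin 2) k) = 1 := by
  rw [← map_one (reduction k m), lastLayer, reduction_eq_iff]
  intro i j
  simp [coe_onePlus]

lemma lastLayer_add (hm : 0 < m) (A B : Matrix (Fin 2) (Fin 2) k) :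
    lastLayer hm (A + B) = lastLayer hm A * lastLayer hm B := by
  rw [lastLayer, lastLayer, lastLayer, ← map_mul, eq_comm, reduction_eq_iff]
  intro i j
  have hprod : (onePlus hm (A.map PowerSeries.C) * onePlus hm (B.map PowerSeries.C)).1 -
      (onePlus hm ((A + B).map PowerSeries.C)).1 =
        (PowerSeries.X : k⟦X⟧) ^ (m + m) • (A.map PowerSeries.C * B.map PowerSeries.C) := by
    rw [Units.val_mul, coe_onePlus, coe_onePlus, coe_onePlus, Matrix.map_add _ (map_add _),
      add_mul, one_mul, mul_add, mul_one, smul_mul_smul_comm, ← pow_add, smul_add]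
    abel
  rw [← Matrix.sub_apply, hprod, Matrix.smul_apply, smul_eq_mul]
  exact (pow_dvd_pow _ (by omega)).mul_right _

variable {C W : Type*} [Field C] [AddCommGroup W] [Module C W]
  {ξ : Representation C (FiniteLevel k m) W}

/-- `w` is an eigenvector of the last layer `1 + t^m M₂(k)`, with the eigencharacter
`1 + t^m A ↦ χ (tr (a A))`. -/
def IsLayerEigenvector (ξ : Representation C (FiniteLevel k m) W) (hm : 0 < m) (χ : AddChar k C)
    (a : Matrix (Fin 2) (Fin 2) k) (w : W) : Prop :=
  ∀ A : Matrix (Fin 2) (Fin 2) k, ξ (lastLayer hm A) w = χ (a * A).trace • w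

lemma isLayerEigenvector_sum [Fintype k] (hm : 0 < m) (χ : AddChar k C)
    (a : Matrix (Fin 2) (Fin 2) k) (w : W) :
    IsLayerEigenvector ξ hm χ a
      (∑ A : Matrix (Fin 2) (Fin 2) k, χ (a * A).trace • ξ (lastLayer hm (-A)) w) := by
  intro B
  rw [map_sum, Finset.smul_sum]
  refine Fintype.sum_equiv (Equiv.subRight B) _ _ fun A => ?_
  rw [map_smul, ← Module.End.mul_apply, ← map_mul, ← lastLayer_add, Equiv.subRight_apply,
    smul_smul, ← AddChar.map_add_eq_mul, ← Matrix.trace_add, ← mul_add, add_sub_cancel, neg_sub,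
    sub_eq_add_neg]

lemma exists_isLayerEigenvector [Finite k] (hchar : (ringChar k : C) ≠ 0) [Nontrivial W]
    (ξ : Representation C (FiniteLevel k m) W) (hm : 0 < m) {χ : AddChar k C} (hχ : χ ≠ 1) :
    ∃ (a : Matrix (Fin 2) (Fin 2) k) (w : W), w ≠ 0 ∧ IsLayerEigenvector ξ hm χ a w := by
  have := Fintype.ofFinite k
  obtain ⟨w, hw⟩ := exists_ne (0 : W)
  have hinversion : ∑ a : Matrix (Fin 2) (Fin 2) k, ∑ A : Matrix (Fin 2) (Fin 2) k,
      χ (a * A).trace • ξ (lastLayer hm (-A)) w =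
        (Nat.card (Matrix (Fin 2) (Fin 2) k) : C) • w := by
    rw [Finset.sum_comm, Finset.sum_eq_single 0 (fun A _ hA => by
      rw [← Finset.sum_smul, sum_addChar_trace_mul_eq_zero hχ hA, zero_smul]) (by simp)]
    simp [lastLayer_zero, Nat.cast_smul_eq_nsmul]
  obtain ⟨a, -, ha⟩ := Finset.exists_ne_zero_of_sum_ne_zero
    (hinversion.trans_ne (smul_ne_zero (natCast_card_ne_zero hchar _) hw))
  exact ⟨a, _, ha, isLayerEigenvector_sum hm χ a w⟩

lemma IsLayerEigenvector.eval_charpoly_ne_zero {hm : 0 < m} {χ : AddChar k C}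
    {a : Matrix (Fin 2) (Fin 2) k} {w : W} (h : IsLayerEigenvector ξ hm χ a w) (hw : w ≠ 0)
    (hN : ¬ ContainsCharOn ξ (unipFiltration k m m) (fun _ => 1)) (l : k) :
    a.charpoly.eval l ≠ 0 := by
  intro hl
  rw [Matrix.eval_charpoly] at hl
  obtain ⟨v, hv0, hv⟩ := Matrix.exists_mulVec_eq_zero_iff.2 hl
  have hav : a.mulVec v = l • v := by
    rw [Matrix.sub_mulVec, sub_eq_zero] at hv
    rw [← hv, Matrix.scalar_apply, ← Matrix.smul_one_eq_diagonal, Matrix.smul_mulVec,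
      Matrix.one_mulVec]
  have hcop : IsCoprime (v 0) (v 1) := by
    rcases Fin.exists_fin_two.1 (Function.ne_iff.1 hv0) with h0 | h1
    · exact ⟨(v 0)⁻¹, 0, by rw [inv_mul_cancel₀ h0, zero_mul, add_zero]⟩
    · exact ⟨0, (v 1)⁻¹, by rw [inv_mul_cancel₀ h1, zero_mul, zero_add]⟩
  obtain ⟨κ, hdet, hκ⟩ := exists_GL_firstColumn (v := PowerSeries.C ∘ v) (hcop.map PowerSeries.C)
  refine hw (eq_zero_of_forall_conj_upperRightHom hN κ fun y => ?_)
  have hconj : κ * upperRightHom (PowerSeries.X ^ m * y) * κ⁻¹ =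
      onePlus hm (y • lineNilpotent (PowerSeries.C ∘ v)) := Units.ext <| by
    rw [conj_upperRightHom_of_det_eq_one hdet, coe_onePlus, smul_smul, funext hκ]
  have hbar : (y • lineNilpotent (PowerSeries.C ∘ v)).map PowerSeries.constantCoeff =
      PowerSeries.constantCoeff y • lineNilpotent v := by
    rw [Matrix.map_smul' _ _ _ (map_mul _), map_lineNilpotent]
    rfl
  rw [hconj, reduction_onePlus_eq_lastLayer, hbar, h, mul_smul_comm, Matrix.trace_smul,
    trace_mul_lineNilpotent_eq_zero hav, smul_zero, AddChar.map_zero_eq_one, one_smul]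

lemma irreducible_charpoly_of_eval_ne_zero {a : Matrix (Fin 2) (Fin 2) k}
    (h : ∀ l, a.charpoly.eval l ≠ 0) : Irreducible a.charpoly := by
  have hdeg : a.charpoly.natDegree = 2 := a.charpoly_natDegree_eq_dim
  rw [a.charpoly_monic.irreducible_iff_roots_eq_zero_of_degree_le_three (by omega) (by omega)]
  exact Multiset.eq_zero_of_forall_notMem fun l hl => h l (Polynomial.isRoot_of_mem_roots hl)

end LastLayer

section ResidueChar

variable {k C : Type*} [Field k] [Field C] {ψ : AddChar k⸨X⸩ C}

/-- The restriction of an additive character of `F` to the constants, that is, for a character of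
level one, the character of `k = O_F / t O_F` it induces. -/
noncomputable def residueChar (ψ : AddChar k⸨X⸩ C) : AddChar k C :=
  ψ.compAddMonoidHom (((algebraMap k⟦X⟧ k⸨X⸩).comp PowerSeries.C : k →+* k⸨X⸩) : k →+ k⸨X⸩)

lemma IsLevelOne.apply_algebraMap (hψ : IsLevelOne ψ) (y : k⟦X⟧) :
    ψ (ιO y) = residueChar ψ (PowerSeries.constantCoeff y) := by
  obtain ⟨z, hz⟩ : PowerSeries.X ∣ y - PowerSeries.C (PowerSeries.constantCoeff y) :=
    PowerSeries.X_dvd_iff.2 (by simp)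
  conv_lhs => rw [sub_eq_iff_eq_add.1 hz, map_add, AddChar.map_add_eq_mul, hψ.1, one_mul]
  rfl

lemma IsLevelOne.residueChar_ne_one (hψ : IsLevelOne ψ) : residueChar ψ ≠ 1 := by
  obtain ⟨y, hy⟩ := hψ.2
  rw [hψ.apply_algebraMap] at hy
  exact AddChar.ne_one_iff.2 ⟨_, hy⟩

lemma IsLevelOne.apply_trace (hψ : IsLevelOne ψ) {n : ℕ} (hn : 0 < n)
    (b B : Matrix (Fin 2) (Fin 2) k⟦X⟧) :
    ψ ((unif k ^ (-(n : ℤ)) • b.map ιO) * ((toGL k (onePlus hn B)).1 - 1)).trace =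
      residueChar ψ (b.map PowerSeries.constantCoeff * B.map PowerSeries.constantCoeff).trace := by
  rw [coe_toGL_onePlus, add_sub_cancel_left, smul_mul_smul_comm, ← zpow_natCast,
    ← zpow_add₀ (unif_ne_zero k), neg_add_cancel, zpow_zero, one_smul, ← Matrix.map_mul,
    ← Matrix.map_mul, ← AddMonoidHom.map_trace (algebraMap k⟦X⟧ k⸨X⸩),
    ← AddMonoidHom.map_trace PowerSeries.constantCoeff, hψ.apply_algebraMap]

end ResidueChar

/-! ### Strata -/

section CongruenceEigenvector

variable {k C V : Type*} [Field k] [Field C] [AddCommGroup V] [Module C V] {n : ℕ}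

/-- `v` is an eigenvector of the group `1 + t^n M₂(O_F)`, with the eigencharacter
`1 + t^n B ↦ χ (tr (a B̄))`, where `B̄` is the reduction of `B` modulo `t`. -/
def IsCongruenceEigenvector (π : Representation C (GL (Fin 2) k⸨X⸩) V) (hn : 0 < n)
    (χ : AddChar k C) (a : Matrix (Fin 2) (Fin 2) k) (v : V) : Prop :=
  ∀ B : Matrix (Fin 2) (Fin 2) k⟦X⟧,
    π (toGL k (onePlus hn B)) v = χ (a * B.map PowerSeries.constantCoeff).trace • v

variable {W : Type*} [AddCommGroup W] [Module C W] {m : ℕ}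
  {ξ : Representation C (FiniteLevel k m) W} {Ξ : Representation C (ZK k) W}

namespace IsCongruenceEigenvector

variable {hn : 0 < n} {χ : AddChar k C} {a : Matrix (Fin 2) (Fin 2) k} {f : cIndSpace (ZK k) Ξ}

lemma apply_diagPow_eq_smul (hf : IsCongruenceEigenvector (cInd (ZK k) Ξ) hn χ a f)
    (hΞ : IsInflation ξ Ξ) {j : ℕ} {κ : GL (Fin 2) k⟦X⟧}
    {B : Matrix (Fin 2) (Fin 2) k⟦X⟧}
    (h : toGL k κ * diagPow k j = diagPow k j * toGL k (onePlus hn B)) :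
    ξ (reduction k m κ) (f.1 (diagPow k j)) =
      χ (a * B.map PowerSeries.constantCoeff).trace • f.1 (diagPow k j) := by
  rw [← hΞ.cInd_toGL_mul, h, ← cInd_apply, hf B]
  rfl

lemma isLayerEigenvector_apply_one {hm : 0 < m}
    (hf : IsCongruenceEigenvector (cInd (ZK k) Ξ) hm χ a f) (hΞ : IsInflation ξ Ξ) :
    IsLayerEigenvector ξ hm χ a (f.1 1) := by
  intro A
  have h := hf.apply_diagPow_eq_smul hΞ (j := 0) (B := A.map PowerSeries.C)
    (by rw [diagPow_zero, mul_one, one_mul])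
  have hA : (A.map PowerSeries.C).map PowerSeries.constantCoeff = A := Matrix.ext fun i l => by simp
  rwa [diagPow_zero, hA] at h

variable (hf : IsCongruenceEigenvector (cInd (ZK k) Ξ) hn χ a f) (hΞ : IsInflation ξ Ξ)
include hf hΞ

lemma apply_diagPow_eq_zero_of_lt (hN : ¬ ContainsCharOn ξ (unipFiltration k m m) (fun _ => 1))
    {j : ℕ} (hj : n < m + j) : f.1 (diagPow k j) = 0 := by
  obtain ⟨d, hd⟩ := Nat.exists_eq_add_of_lt hj
  refine eq_zero_of_forall_upperRightHom hN fun y => ?_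
  let B : Matrix (Fin 2) (Fin 2) k⟦X⟧ := !![0, PowerSeries.X ^ (d + 1) * y; 0, 0]
  have hB : B.map PowerSeries.constantCoeff = 0 := by
    ext i l
    fin_cases i <;> fin_cases l <;> simp [B]
  have hpow : PowerSeries.X ^ j * (PowerSeries.X ^ m * y) =
      PowerSeries.X ^ n * (PowerSeries.X ^ (d + 1) * y) := by
    rw [← mul_assoc, ← mul_assoc, ← pow_add, ← pow_add, add_comm j, hd, add_assoc]
  have h := hf.apply_diagPow_eq_smul hΞ (κ := upperRightHom (PowerSeries.X ^ m * y)) (j := j)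
    (B := B) (by apply toGL_mul_diagPow <;> simp [coe_onePlus, B, hpow])
  rw [h, hB, mul_zero, Matrix.trace_zero, AddChar.map_zero_eq_one, one_smul]

lemma det_eq_zero_of_lt (hχ : χ ≠ 1) (hmn : m < n) {j : ℕ} (hfj : f.1 (diagPow k j) ≠ 0) :
    a.det = 0 := by
  have hrow (x y : k) : χ (a 0 0 * x + a 0 1 * y) = 1 := by
    have h := hf.apply_diagPow_eq_smul hΞ (j := j)
      (κ := onePlus hn !![PowerSeries.C x, 0; PowerSeries.X ^ j * PowerSeries.C y, 0])
      (B := !![PowerSeries.C x, 0; PowerSeries.C y, 0])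
      (by apply toGL_mul_diagPow <;> simp [coe_onePlus, mul_left_comm])
    rw [reduction_onePlus_eq_one hn hmn, map_one, Module.End.one_apply] at h
    refine (smul_left_injective C hfj ?_).symm
    simpa [Matrix.trace_fin_two, Matrix.mul_apply, Fin.sum_univ_two] using h
  obtain ⟨z, hz⟩ := AddChar.ne_one_iff.1 hχ
  have h00 : a 0 0 = 0 := by
    by_contra h
    exact hz (by simpa [h] using hrow ((a 0 0)⁻¹ * z) 0)
  have h01 : a 0 1 = 0 := by
    by_contra h
    exact hz (by simpa [h] using hrow 0 ((a 0 1)⁻¹ * z))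
  rw [Matrix.det_fin_two, h00, h01, zero_mul, zero_mul, sub_zero]

theorem eval_charpoly_ne_zero (hχ : χ ≠ 1)
    (hN : ¬ ContainsCharOn ξ (unipFiltration k m m) (fun _ => 1)) (ha : a.det ≠ 0) {j : ℕ}
    (hfj : f.1 (diagPow k j) ≠ 0) (l : k) : a.charpoly.eval l ≠ 0 := by
  have hj : m + j ≤ n := not_lt.1 fun h => hfj (hf.apply_diagPow_eq_zero_of_lt hΞ hN h)
  have hnm : n ≤ m := not_lt.1 fun h => ha (hf.det_eq_zero_of_lt hΞ hχ h hfj)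
  obtain rfl : n = m := by omega
  obtain rfl : j = 0 := by omega
  rw [diagPow_zero] at hfj
  exact (hf.isLayerEigenvector_apply_one hΞ).eval_charpoly_ne_zero hfj hN l

end IsCongruenceEigenvector

end CongruenceEigenvector

section StratumAction

variable {k : Type*} [Field k]

lemma mul_mem_radPow {Λ : LatticeChain k} {a b : ℤ} {x y : Matrix (Fin 2) (Fin 2) k⸨X⸩}
    (hx : x ∈ Λ.radPow a) (hy : y ∈ Λ.radPow b) : x * y ∈ Λ.radPow (a + b) := by
  intro i v hv
  rw [← Matrix.mulVec_mulVec, add_comm a, ← add_assoc]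
  exact hx _ _ (hy _ _ hv)

lemma toGL_mem_stdChain_radPow (κ : GL (Fin 2) k⟦X⟧) : (toGL k κ).1 ∈ (stdChain k).radPow 0 :=
  mem_stdChain_radPow.2 fun i j => mem_fracIdeal_zero.2 ⟨κ i j, rfl⟩

lemma toGL_conj_mem_stdChain_radPow (κ : GL (Fin 2) k⟦X⟧) {n : ℤ}
    {x : Matrix (Fin 2) (Fin 2) k⸨X⸩} (hx : x ∈ (stdChain k).radPow n) :
    (toGL k κ)⁻¹.1 * x * (toGL k κ).1 ∈ (stdChain k).radPow n := by
  have h := mul_mem_radPow (mul_mem_radPow (toGL_mem_stdChain_radPow κ⁻¹) hx)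
    (toGL_mem_stdChain_radPow κ)
  rwa [zero_add, add_zero, map_inv] at h

lemma toGL_smul_radPow_eq {Λ : LatticeChain k} (hΛ : Λ.radPow = (stdChain k).radPow)
    (κ : GL (Fin 2) k⟦X⟧) : (toGL k κ • Λ).radPow = (stdChain k).radPow := by
  refine funext fun n => Set.ext fun x => ?_
  rw [LatticeChain.mem_smul_radPow, hΛ]
  refine ⟨fun h => ?_, toGL_conj_mem_stdChain_radPow κ⟩
  have h' := toGL_conj_mem_stdChain_radPow κ⁻¹ h
  rwa [map_inv, inv_inv, mul_assoc, mul_assoc, Units.mul_inv, mul_one, Units.mul_inv_cancel_left]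
    at h'

namespace Stratum

/-- Conjugation of a stratum by an element of `GL₂(F)`. -/
noncomputable instance : SMul (GL (Fin 2) k⸨X⸩) (Stratum k) where
  smul g s :=
    { chain := g • s.chain
      n := s.n
      n_pos := s.n_pos
      a := g.1 * s.a * g⁻¹.1
      mem := by
        rw [LatticeChain.mem_smul_radPow, mul_assoc, mul_assoc, mul_assoc, Units.inv_mul, mul_one,
          Units.inv_mul_cancel_left]
        exact s.mem }

variable {s : Stratum k} {p : Polynomial k}

lemma IsReducedCharpoly.smul (hp : s.IsReducedCharpoly p) (g : GL (Fin 2) k⸨X⸩) :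
    (g • s).IsReducedCharpoly p := by
  obtain ⟨F, hF, rfl⟩ := hp
  refine ⟨F, ?_, rfl⟩
  change _ = (unif k ^ s.n • (g.1 * s.a * g⁻¹.1)).charpoly
  rw [← smul_mul_assoc, ← mul_smul_comm, Matrix.coe_units_inv, Matrix.charpoly_units_conj, hF]

lemma IsReducedCharpoly.exists_eq_smul_map (hp : s.IsReducedCharpoly p)
    (hs : s.chain.radPow = (stdChain k).radPow) :
    ∃ b : Matrix (Fin 2) (Fin 2) k⟦X⟧, s.a = unif k ^ (-(s.n : ℤ)) • b.map ιO ∧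
      (b.map PowerSeries.constantCoeff).charpoly = p := by
  obtain ⟨F, hF, rfl⟩ := hp
  have hmem := s.mem
  rw [hs, mem_stdChain_radPow] at hmem
  choose b hb using hmem
  have hab : s.a = unif k ^ (-(s.n : ℤ)) • (Matrix.of b).map ιO := Matrix.ext hb
  refine ⟨.of b, hab, ?_⟩
  rw [hab, smul_smul, ← zpow_natCast, ← zpow_add₀ (unif_ne_zero k), add_neg_cancel, zpow_zero,
    one_smul, Matrix.charpoly_map] at hF
  rw [Matrix.charpoly_map, Polynomial.map_injective _ algebraMap_powerSeries_injective hF]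

variable {C V : Type*} [Field C] [AddCommGroup V] [Module C V] {ψ : AddChar k⸨X⸩ C}
  {π : Representation C (GL (Fin 2) k⸨X⸩) V} {v : V}

lemma apply_eq_smul_of_mem_smul_unitGroup
    (hv : ∀ u ∈ s.chain.unitGroup s.n, π u v = ψ (s.a * (u.1 - 1)).trace • v)
    (g : GL (Fin 2) k⸨X⸩) : ∀ u ∈ (g • s).chain.unitGroup (g • s).n,
      π u (π g v) = ψ ((g • s).a * (u.1 - 1)).trace • π g v := by
  intro u hu
  have hconj : (g⁻¹ * u * g).1 - 1 = g⁻¹.1 * (u.1 - 1) * g.1 := by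
    rw [mul_sub, sub_mul, mul_one, Units.inv_mul, Units.val_mul, Units.val_mul]
  have htrace : (s.a * ((g⁻¹ * u * g).1 - 1)).trace = (g.1 * s.a * g⁻¹.1 * (u.1 - 1)).trace := by
    rw [hconj, ← mul_assoc, Matrix.trace_mul_comm]
    simp only [mul_assoc]
  rw [GLTwo.apply_eq_smul_of_mem_smul_unitGroup hv hu, htrace]
  rfl

lemma exists_isCongruenceEigenvector (hψ : IsLevelOne ψ) (hp : s.IsReducedCharpoly p)
    (hs : s.chain.radPow = (stdChain k).radPow)
    (hv : ∀ u ∈ s.chain.unitGroup s.n, π u v = ψ (s.a * (u.1 - 1)).trace • v) :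
    ∃ a : Matrix (Fin 2) (Fin 2) k, a.charpoly = p ∧
      IsCongruenceEigenvector π s.n_pos (residueChar ψ) a v := by
  obtain ⟨b, hab, hb⟩ := hp.exists_eq_smul_map hs
  refine ⟨_, hb, fun B => ?_⟩
  have hmem : toGL k (onePlus s.n_pos B) ∈ s.chain.unitGroup s.n := by
    rw [LatticeChain.unitGroup, hs]
    exact (mem_stdChain_unitGroup s.n_pos).2 ⟨B, rfl⟩
  rw [hv _ hmem, hab, hψ.apply_trace]

end Stratum

end StratumAction

section InflationStrata

variable {k C W : Type*} [Field k] [Field C] [AddCommGroup W] [Module C W] {m : ℕ}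
  {ξ : Representation C (FiniteLevel k m) W} {Ξ : Representation C (ZK k) W} {ψ : AddChar k⸨X⸩ C}

namespace IsInflation

variable (hΞ : IsInflation ξ Ξ) (hN : ¬ ContainsCharOn ξ (unipFiltration k m m) (fun _ => 1))
  (hψ : IsLevelOne ψ)
include hΞ hN hψ

theorem exists_unramifiedSimple_stratum [Finite k] (hchar : (ringChar k : C) ≠ 0) [Nontrivial W]
    (hm : 0 < m) :
    ∃ s : Stratum k, s.chain = stdChain k ∧ s.n = m ∧ s.IsUnramifiedSimple ∧
      ContainsStratum ψ (cInd (ZK k) Ξ) s := by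
  obtain ⟨a, w, hw, ha⟩ := exists_isLayerEigenvector hchar ξ hm hψ.residueChar_ne_one
  let b : Matrix (Fin 2) (Fin 2) k⟦X⟧ := a.map PowerSeries.C
  have hb : b.map PowerSeries.constantCoeff = a := Matrix.ext fun i j => by simp [b]
  have hmem : unif k ^ (-(m : ℤ)) • b.map ιO ∈ (stdChain k).radPow (-m) :=
    mem_stdChain_radPow.2 fun i j => ⟨b i j, rfl⟩
  refine ⟨⟨stdChain k, m, hm, _, hmem⟩, rfl, rfl, ⟨rfl, a.charpoly, ⟨b.charpoly, ?_, ?_⟩, ?_⟩,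
    hΞ.single w, (map_ne_zero_iff _ (cIndSingle_injective _ _)).2 hw, fun u hu => ?_⟩
  · change _ = (unif k ^ m • unif k ^ (-(m : ℤ)) • b.map ιO).charpoly
    rw [smul_smul, ← zpow_natCast, ← zpow_add₀ (unif_ne_zero k), add_neg_cancel, zpow_zero,
      one_smul, ← Matrix.charpoly_map]
  · rw [← Matrix.charpoly_map, hb]
  · exact irreducible_charpoly_of_eval_ne_zero fun l => ha.eval_charpoly_ne_zero hw hN l
  · obtain ⟨B, rfl⟩ := (mem_stdChain_unitGroup hm).1 hu
    rw [cInd_toGL_single, reduction_onePlus_eq_lastLayer, ha, map_smul]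
    beta_reduce
    rw [hψ.apply_trace hm b B, hb]

theorem not_containsStratum_of_isRoot {s : Stratum k} (he : s.chain.e = 1) {p : Polynomial k}
    (hp : s.IsReducedCharpoly p) (hp0 : p.eval 0 ≠ 0) {l : k} (hl : p.IsRoot l) :
    ¬ ContainsStratum ψ (cInd (ZK k) Ξ) s := by
  rintro ⟨f, hf0, hf⟩
  obtain ⟨γ, hγ⟩ := LatticeChain.exists_smul_radPow_eq he
  have hγf : cInd (ZK k) Ξ γ f = 0 := eq_zero_of_forall_diagPow_mul_toGL fun j κ => by
    by_contra hne
    have hsmul := Stratum.apply_eq_smul_of_mem_smul_unitGroup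
      (Stratum.apply_eq_smul_of_mem_smul_unitGroup hf γ) (toGL k κ)
    obtain ⟨a, ha, heig⟩ := Stratum.exists_isCongruenceEigenvector hψ
      ((hp.smul γ).smul (toGL k κ)) (toGL_smul_radPow_eq hγ κ) hsmul
    rw [← ha, ← Polynomial.coeff_zero_eq_eval_zero] at hp0
    refine heig.eval_charpoly_ne_zero hΞ hψ.residueChar_ne_one hN ?_ (j := j) ?_ l ?_
    · rw [Matrix.det_eq_sign_charpoly_coeff]
      exact mul_ne_zero (pow_ne_zero _ (neg_ne_zero.2 one_ne_zero)) hp0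
    · rwa [cInd_apply]
    · rw [ha]
      exact hl
  have hf' := congrArg (cInd (ZK k) Ξ γ⁻¹) hγf
  rw [← Module.End.mul_apply, ← map_mul, inv_mul_cancel, map_one, Module.End.one_apply,
    map_zero] at hf'
  exact hf0 hf'

theorem not_containsStratum_of_isEssentiallyScalar {s : Stratum k} (hs : s.IsEssentiallyScalar) :
    ¬ ContainsStratum ψ (cInd (ZK k) Ξ) s := by
  obtain ⟨he, c, hc, hred⟩ := hs
  exact hΞ.not_containsStratum_of_isRoot hN hψ he hred (by simpa using hc) (l := c) (by simp)

end IsInflation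

end InflationStrata

end GLTwo

theorem mainTheorem10_general {k C W : Type*} [Field k] [Finite k] [Field C]
    [AddCommGroup W] [Module C W] (hchar : (ringChar k : C) ≠ 0) (m : ℕ)
    (ξ : Representation C (GLTwo.FiniteLevel k m) W) (hirr : ξ.IsIrreducible)
    (hN : ¬ GLTwo.ContainsCharOn ξ (GLTwo.unipFiltration k m m) (fun _ => 1))
    (Ξ : Representation C (GLTwo.ZK k) W) (hΞ : GLTwo.IsInflation ξ Ξ) :
    (GLTwo.cInd (GLTwo.ZK k) Ξ).IsIrreducible ∧
    GLTwo.IsCuspidal (GLTwo.cInd (GLTwo.ZK k) Ξ) ∧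
    GLTwo.IsAdmissible (GLTwo.cInd (GLTwo.ZK k) Ξ) ∧
    (∀ ψ : AddChar k⸨X⸩ C, GLTwo.IsLevelOne ψ →
      (0 < m → ∃ s : GLTwo.Stratum k, s.chain = GLTwo.stdChain k ∧ s.n = m ∧
        s.IsUnramifiedSimple ∧ GLTwo.ContainsStratum ψ (GLTwo.cInd (GLTwo.ZK k) Ξ) s) ∧
      ¬ ∃ s : GLTwo.Stratum k,
        s.IsEssentiallyScalar ∧ GLTwo.ContainsStratum ψ (GLTwo.cInd (GLTwo.ZK k) Ξ) s) ∧
    GLTwo.HasLevel (GLTwo.cInd (GLTwo.ZK k) Ξ) m ∧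
    ∀ φ : k⸨X⸩ˣ →* Cˣ, IsOpen (φ.ker : Set k⸨X⸩ˣ) →
      ∃ r : ℚ, GLTwo.HasLevel (GLTwo.twist φ (GLTwo.cInd (GLTwo.ZK k) Ξ)) r ∧ (m : ℚ) ≤ r := by
  have := GLTwo.nontrivial_of_isIrreducible hirr
  exact ⟨hΞ.cInd_isIrreducible hN hchar hirr, hΞ.cInd_isCuspidal hN hchar hirr,
    hΞ.cInd_isAdmissible hN hirr,
    fun ψ hψ => ⟨hΞ.exists_unramifiedSimple_stratum hN hψ hchar,
      fun ⟨_, hs, hcont⟩ => hΞ.not_containsStratum_of_isEssentiallyScalar hN hψ hs hcont⟩,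
    hΞ.cInd_hasLevel hN, fun _ hφ => hΞ.exists_hasLevel_twist hN hφ⟩

theorem mainTheorem10 {k C W : Type*} [Field k] [Finite k] [Field C] [IsAlgClosed C] [CharZero C]
    [AddCommGroup W] [Module C W] (m : ℕ)
    (ξ : Representation C (GLTwo.FiniteLevel k m) W) (hirr : ξ.IsIrreducible)
    (hN : ¬ GLTwo.ContainsCharOn ξ (GLTwo.unipFiltration k m m) (fun _ => 1))
    (Ξ : Representation C (GLTwo.ZK k) W)
    (hΞ : ∀ g : GL (Fin 2) k⟦X⟧, Ξ (GLTwo.toZK k g) = ξ (GLTwo.reduction k m g)) :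
    (GLTwo.cInd (GLTwo.ZK k) Ξ).IsIrreducible ∧
    GLTwo.IsCuspidal (GLTwo.cInd (GLTwo.ZK k) Ξ) ∧
    GLTwo.IsAdmissible (GLTwo.cInd (GLTwo.ZK k) Ξ) ∧
    (0 < m →
      (∀ ψ : AddChar k⸨X⸩ C, GLTwo.IsLevelOne ψ →
        (∃ s : GLTwo.Stratum k, s.chain = GLTwo.stdChain k ∧ s.n = m ∧
          s.IsUnramifiedSimple ∧ GLTwo.ContainsStratum ψ (GLTwo.cInd (GLTwo.ZK k) Ξ) s) ∧
        ¬ ∃ s : GLTwo.Stratum k,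
          s.IsEssentiallyScalar ∧ GLTwo.ContainsStratum ψ (GLTwo.cInd (GLTwo.ZK k) Ξ) s) ∧
      GLTwo.HasLevel (GLTwo.cInd (GLTwo.ZK k) Ξ) m ∧
      ∀ φ : k⸨X⸩ˣ →* Cˣ, IsOpen (φ.ker : Set k⸨X⸩ˣ) →
        ∃ r : ℚ, GLTwo.HasLevel (GLTwo.twist φ (GLTwo.cInd (GLTwo.ZK k) Ξ)) r ∧
          0 < (m : ℚ) ∧ (m : ℚ) ≤ r) := by
  have hchar : (ringChar k : C) ≠ 0 := Nat.cast_ne_zero.2 (CharP.ringChar_ne_zero_of_finite k)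
  obtain ⟨hirreducible, hcuspidal, hadmissible, hstrata, hlevel, htwist⟩ :=
    mainTheorem10_general hchar m ξ hirr hN Ξ hΞ
  exact ⟨hirreducible, hcuspidal, hadmissible, fun hm =>
    ⟨fun ψ hψ => ⟨(hstrata ψ hψ).1 hm, (hstrata ψ hψ).2⟩, hlevel,
      fun φ hφ => (htwist φ hφ).imp fun _ h => ⟨h.1, Nat.cast_pos.2 hm, h.2⟩⟩⟩
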